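/- Let $k$ be an algebraically closed field (of any characteristic). Let $\mathbb{F}_q$ be a finite field with $q$ elements, let $n\ge 0$ be an integer, let $\ell$ be a prime number with $\ell\nmid q$, and let $G$ be an $\ell$-Sylow subgroup of $\mathrm{GL}_n(\mathbb{F}_q)$. Let $V$ be a faithful finite-dimensional representation of $G$ over $k$. Then the quotient variety $V/G=\operatorname{Spec} k[V]^G$ is stably rational over $k$, i.e. there are integers $m,r\ge 0$ such that $(V/G)\times\mathbb{A}^m_k$ is birational over $k$ to the affine space $\mathbb{A}^r_k$. -/

import Mathlib

open CategoryTheory AlgebraicGeometry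

universe u

/-- Two schemes `X`, `Y` over `S` are stably birational over `S` if the relative affine spaces
`X ×_S 𝔸ᵐ` and `Y ×_S 𝔸ⁿ` are birational over `S` for some natural numbers `m`, `n`. -/
def StablyBirationalOver {S X Y : Scheme.{u}} (sX : X ⟶ S) (sY : Y ⟶ S) : Prop :=
  ∃ m n : ℕ, Scheme.BirationalOver
    ((𝔸(ULift.{u} (Fin m); X) ↘ X) ≫ sX) ((𝔸(ULift.{u} (Fin n); Y) ↘ Y) ≫ sY)

/-- `X` is stably rational over `S` if it is stably birational over `S` to `S` itself, that is, if
`X ×_S 𝔸ᵐ` is birational over `S` to the affine space `𝔸(n; S)` for some natural numbers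
`m`, `n`. -/
def IsStablyRationalOver {S X : Scheme.{u}} (sX : X ⟶ S) : Prop :=
  StablyBirationalOver sX (𝟙 S)

section Quotient

variable {k G V : Type*} [Field k] [Group G] [AddCommGroup V] [Module k V]

/-- The action of `g` on the coordinate ring `k[V] = Sym(V*)` of the affine space `V`: the
`k`-algebra endomorphism which on linear forms is `f ↦ f ∘ ρ(g⁻¹)`. -/
noncomputable def Representation.coordAct (ρ : Representation k G V) (g : G) :
    SymmetricAlgebra k (Module.Dual k V) →ₐ[k] SymmetricAlgebra k (Module.Dual k V) :=
  SymmetricAlgebra.lift (SymmetricAlgebra.ι k (Module.Dual k V) ∘ₗ ρ.dual g)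

/-- The ring of polynomial invariants `k[V]^G`. -/
noncomputable def Representation.polyInvariants (ρ : Representation k G V) :
    Subalgebra k (SymmetricAlgebra k (Module.Dual k V)) where
  carrier := {f | ∀ g : G, ρ.coordAct g f = f}
  mul_mem' ha hb g := by rw [map_mul, ha g, hb g]
  add_mem' ha hb g := by rw [map_add, ha g, hb g]
  algebraMap_mem' r g := (ρ.coordAct g).commutes r

end Quotient

section QuotientScheme

variable {k V : Type u} {G : Type*} [Field k] [Group G] [AddCommGroup V] [Module k V]

/-- The quotient variety `V/G = Spec k[V]^G`. -/
noncomputable def Representation.quotientVariety (ρ : Representation k G V) : Scheme.{u} :=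
  Spec (CommRingCat.of ρ.polyInvariants)

/-- The structure morphism `V/G ⟶ Spec k`. -/
noncomputable def Representation.quotientVarietyStr (ρ : Representation k G V) :
    ρ.quotientVariety ⟶ Spec (CommRingCat.of k) :=
  Spec.map (CommRingCat.ofHom (algebraMap k ρ.polyInvariants))

end QuotientScheme

/-! Whether V/G is stably rational does not depend on the faithful representation. For faithful L
and U, the field k(L ⊕ U)^G is purely transcendental over both k(L)^G and k(U)^G: this is the
no-name lemma, `Representation.isPurelyTranscendental_fixedField`. One faithful representation with
rational field of invariants therefore suffices. That condition, `HasRationalInvariants`, depends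
only on the abstract group, so it may be checked on any group isomorphic to G.

If ℓ ≠ char k, G is modelled by wreath products. A Sylow subgroup of a symmetric group is an
iterated wreath product of ℤ/ℓ. Let e be the order of q modulo ℓ. For ℓ odd, or ℓ = 2 and q ≡ 1 mod
4, G is the wreath product of the cyclic ℓ-Sylow subgroup D of the units of 𝔽_{q^e} with a Sylow
subgroup of the symmetric group on ⌊n/e⌋ letters. For ℓ = 2 and q ≡ 3 mod 4, D is a Sylow subgroup
of GL₂(𝔽_q), which has a cyclic subgroup of index two; the letters number ⌊n/2⌋, and n odd adds a
factor {±1}. Each identification is an embedding plus a count of orders. In all cases D acts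
faithfully on a plane W. By the theorems of Miyata and Lüroth, two elements generate k(W)^D. Their
copies in k(W^X) generate the invariants of D^X and are permuted by P, so the no-name lemma carries
rationality from P to the wreath product (`HasRationalInvariants.of_ker`,
`HasRationalInvariants.wreath`).

If ℓ = char k, an ℓ-group acts unitriangularly, and Miyata's theorem along an invariant flag shows
that the invariants are rational.

The geometric statement follows because k[V]^G is finitely generated with fraction field the field
of invariants, and integral affine varieties with the same function field are birational. -/

/-- The subfield fixed by a group acting by field automorphisms. -/
noncomputable def MonoidHom.fixedField {k K G : Type*} [Field k] [Field K] [Algebra k K] [Group G]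
    (φ : G →* (K ≃ₐ[k] K)) : IntermediateField k K :=
  IntermediateField.fixedField φ.range

/-! ### Fixed fields, Galois descent and the no-name lemma for fields -/

section FixedField

variable {k K G : Type*} [Field k] [Field K] [Algebra k K] [Group G]

lemma MonoidHom.mem_fixedField {φ : G →* (K ≃ₐ[k] K)} {x : K} :
    x ∈ φ.fixedField ↔ ∀ g, φ g x = x := by
  simp [MonoidHom.fixedField]

lemma MonoidHom.rank_fixedField [Finite G] {φ : G →* (K ≃ₐ[k] K)} (hφ : Function.Injective φ) :
    Module.rank φ.fixedField K = Nat.card G := by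
  have : Finite φ.range := Finite.of_surjective _ φ.rangeRestrict_surjective
  have := Fintype.ofFinite φ.range
  have h1 : Module.finrank φ.fixedField K = Nat.card φ.range := by
    rw [Nat.card_eq_fintype_card]
    exact FixedPoints.finrank_eq_card φ.range K
  rw [Nat.card_congr (MonoidHom.ofInjective hφ).toEquiv, ← h1]
  have : FiniteDimensional φ.fixedField K :=
    inferInstanceAs (FiniteDimensional (FixedPoints.subfield φ.range K) K)
  exact (Module.finrank_eq_rank _ _).symm

/-- A subfield of the fixed field of small enough codegree is the whole fixed field. -/
lemma MonoidHom.eq_fixedField_of_rank_le [Finite G] {φ : G →* (K ≃ₐ[k] K)}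
    (hφ : Function.Injective φ) {E : IntermediateField k K} (hE : E ≤ φ.fixedField)
    (h : Module.rank E K ≤ Nat.card G) : φ.fixedField = E := by
  have hfin : FiniteDimensional E K :=
    Module.rank_lt_aleph0_iff.mp (h.trans_lt Cardinal.natCast_lt_aleph0)
  refine (IntermediateField.eq_of_le_of_finrank_le' hE ?_).symm
  rw [← Module.finrank_eq_rank, Nat.cast_le] at h
  refine h.trans_eq ?_
  have := φ.rank_fixedField hφ
  exact (Module.finrank_eq_of_rank_eq this).symm

lemma isAlgebraic_of_adjoin_eq_top {s : Set K} (h : IntermediateField.adjoin k s = ⊤) :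
    Algebra.IsAlgebraic (Algebra.adjoin k s) K := by
  refine ⟨fun y ↦ ?_⟩
  have hy : y ∈ IntermediateField.adjoin k s := h ▸ IntermediateField.mem_top
  obtain ⟨a, ha, b, hb, rfl⟩ := IntermediateField.mem_adjoin_iff_div.mp hy
  rw [div_eq_mul_inv]
  exact (isAlgebraic_algebraMap (⟨a, ha⟩ : Algebra.adjoin k s)).mul
    (isAlgebraic_algebraMap (⟨b, hb⟩ : Algebra.adjoin k s)).inv

/-- A generating family contains a transcendence basis, so a family no longer than the transcendence
degree is one. Algebraic independence of generators of invariants is obtained from this count. -/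
lemma algebraicIndependent_of_natCard_le_trdeg {ι : Type*} [Finite ι] {x : ι → K}
    (hgen : IntermediateField.adjoin k (Set.range x) = ⊤)
    (h : (Nat.card ι : Cardinal) ≤ Algebra.trdeg k K) : AlgebraicIndependent k x := by
  have := isAlgebraic_of_adjoin_eq_top hgen
  refine (Algebra.IsAlgebraic.isTranscendenceBasis_of_lift_le_trdeg_of_finite k x ?_).1
  rw [← Nat.cast_card, Cardinal.lift_natCast]
  simpa using h

section Compat

variable {M : Type*} [Field M] [Algebra k M] [Algebra K M]
  {φ : G →* (K ≃ₐ[k] K)} {ψ : G →* (M ≃ₐ[k] M)}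

/-- Galois descent for vector spaces: a stable subspace is spanned by its invariants. -/
lemma Submodule.span_invariants_eq [Finite G] (hφ : Function.Injective φ)
    (hc : ∀ g a, ψ g (algebraMap K M a) = algebraMap K M (φ g a))
    (W : Submodule K M) (hW : ∀ g, ∀ w ∈ W, ψ g w ∈ W) :
    W = Submodule.span K {w | w ∈ W ∧ ∀ g, ψ g w = w} := by
  classical
  have := Fintype.ofFinite G
  refine le_antisymm ?_ (Submodule.span_le.mpr fun w hw ↦ hw.1)
  by_contra hcon
  obtain ⟨w, hw, hwn⟩ := SetLike.not_le_iff_exists.mp hcon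
  obtain ⟨f, hfw, hf⟩ := Submodule.exists_le_ker_of_notMem hwn
  -- The trace of `c • w` is an invariant of `W`, hence killed by `f`. Letting `c` vary gives a
  -- linear relation between the distinct automorphisms `φ g`; by Dedekind its coefficient at `g =
  -- 1`, which is `f w`, vanishes.
  have htr : ∀ c : K, ∑ g : G, φ g c * f (ψ g w) = 0 := by
    intro c
    have h1 : (∑ g : G, ψ g (c • w)) ∈
        Submodule.span K {w | w ∈ W ∧ ∀ g, ψ g w = w} := by
      refine Submodule.subset_span ⟨Submodule.sum_mem _ fun g _ ↦ hW g _ (W.smul_mem c hw), ?_⟩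
      intro h
      rw [map_sum]
      refine Fintype.sum_equiv (Equiv.mulLeft h) _ _ fun g ↦ ?_
      simp [map_mul]
    have h2 := hf h1
    rw [LinearMap.mem_ker, map_sum] at h2
    rw [← h2]
    refine Finset.sum_congr rfl fun g _ ↦ ?_
    rw [Algebra.smul_def, map_mul, hc, ← Algebra.smul_def, map_smul, smul_eq_mul]
  have hind : LinearIndependent K (fun g : G ↦ (⇑(φ g : K →* K) : K → K)) :=
    (linearIndependent_monoidHom K K).comp (fun g : G ↦ (φ g : K →* K)) fun g h hgh ↦ hφ <| by
      ext a
      exact DFunLike.congr_fun hgh a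
  have h3 := Fintype.linearIndependent_iff.mp hind (fun g ↦ f (ψ g w)) (by
    ext c
    simpa [mul_comm] using htr c) 1
  exact hfw (by simpa using h3)

variable [IsScalarTower k K M]

/-- If `M` is generated over `K` by invariants `t`, then `M^G = K^G(t)`. -/
lemma MonoidHom.fixedField_eq_adjoin [Finite G] (hφ : Function.Injective φ)
    (hc : ∀ g a, ψ g (algebraMap K M a) = algebraMap K M (φ g a))
    {t : Set M} (ht : ∀ g, ∀ x ∈ t, ψ g x = x)
    (hgen : IntermediateField.adjoin K t = ⊤) :
    ψ.fixedField = (IntermediateField.adjoin φ.fixedField t).restrictScalars k := by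
  have hψ : Function.Injective ψ := fun g h hgh ↦ hφ <| by
    ext a
    apply (algebraMap K M).injective
    rw [← hc, ← hc, hgh]
  refine MonoidHom.eq_fixedField_of_rank_le hψ ?_ ?_
  · have h1 : ∀ x ∈ IntermediateField.adjoin φ.fixedField t, ∀ g, ψ g x = x := by
      intro x hx g
      induction hx using IntermediateField.adjoin_induction with
      | mem x hx => exact ht g x hx
      | algebraMap a =>
        rw [IsScalarTower.algebraMap_apply φ.fixedField K M, hc]
        congr 1
        exact MonoidHom.mem_fixedField.mp a.2 g
      | add x y _ _ hx hy => rw [map_add, hx, hy]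
      | mul x y _ _ hx hy => rw [map_mul, hx, hy]
      | inv x _ hx => rw [map_inv₀, hx]
    exact fun x hx ↦ MonoidHom.mem_fixedField.mpr (h1 x hx)
  -- `M` is generated over `T = K^G(t)` by the image of `K`, which has degree |G| over `K^G`; so [M
  -- : T] ≤ |G|, as Artin's criterion requires.
  · set L : IntermediateField φ.fixedField M := (IsScalarTower.toAlgHom φ.fixedField K M).fieldRange
    set T := IntermediateField.adjoin φ.fixedField t
    have hfd : FiniteDimensional φ.fixedField K := by
      apply Module.rank_lt_aleph0_iff.mp
      rw [φ.rank_fixedField hφ]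
      exact Cardinal.natCast_lt_aleph0
    have e : K ≃ₗ[φ.fixedField] L :=
      (AlgEquiv.ofInjectiveField (IsScalarTower.toAlgHom φ.fixedField K M)).toLinearEquiv
    have : FiniteDimensional φ.fixedField L := Module.Finite.equiv e
    have h2 : Module.rank φ.fixedField L = Nat.card G := by
      have h3 : Module.finrank φ.fixedField L = Nat.card G := by
        rw [← e.finrank_eq]
        exact Module.finrank_eq_of_rank_eq (φ.rank_fixedField hφ)
      rw [← h3, Module.finrank_eq_rank]
    have h4 := IntermediateField.adjoin_rank_le_of_isAlgebraic_right (E := T) L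
    rw [h2] at h4
    have h5 : IntermediateField.adjoin T (L : Set M) = ⊤ := by
      rw [eq_top_iff]
      rintro x -
      have hx : x ∈ IntermediateField.adjoin K t := hgen ▸ IntermediateField.mem_top
      induction hx using IntermediateField.adjoin_induction with
      | mem x hx =>
        have : x ∈ T := IntermediateField.subset_adjoin _ _ hx
        exact IntermediateField.algebraMap_mem _ (⟨x, this⟩ : T)
      | algebraMap a => exact IntermediateField.subset_adjoin _ _ ⟨a, rfl⟩
      | add x y _ _ hx hy => exact add_mem hx hy
      | mul x y _ _ hx hy => exact mul_mem hx hy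
      | inv x _ hx => exact inv_mem hx
    rw [h5] at h4
    refine le_trans (le_of_eq ?_) h4
    exact (IntermediateField.topEquiv (F := T) (E := M)).toLinearEquiv.rank_eq.symm

/-- The no-name lemma: if `M = K(z)` is purely transcendental and `G` acts semilinearly on the
`K`-span of `z`, then `M^G` is purely transcendental over `K^G`. -/
theorem MonoidHom.exists_fixedField_eq_adjoin_of_span [Finite G] (hφ : Function.Injective φ)
    (hc : ∀ g a, ψ g (algebraMap K M a) = algebraMap K M (φ g a))
    {ι : Type*} [Finite ι] (z : ι → M) (hgen : IntermediateField.adjoin K (Set.range z) = ⊤)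
    (htr : (Nat.card ι : Cardinal) ≤ Algebra.trdeg K M)
    (hz : ∀ g i, ψ g (z i) ∈ Submodule.span K (Set.range z)) :
    ∃ (r : ℕ) (t : Fin r → M), AlgebraicIndependent K t ∧
      ψ.fixedField = (IntermediateField.adjoin φ.fixedField (Set.range t)).restrictScalars k := by
  set W := Submodule.span K (Set.range z)
  have hfin : FiniteDimensional K W := FiniteDimensional.span_of_finite K (Set.finite_range z)
  have hWst : ∀ g, ∀ w ∈ W, ψ g w ∈ W := by
    intro g w hw
    induction hw using Submodule.span_induction with
    | mem x hx => obtain ⟨i, rfl⟩ := hx; exact hz g i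
    | zero => simp
    | add x y _ _ hx hy => rw [map_add]; exact add_mem hx hy
    | smul a x _ hx =>
      rw [Algebra.smul_def, map_mul, hc, ← Algebra.smul_def]
      exact W.smul_mem _ hx
  have hspan := Submodule.span_invariants_eq hφ hc W hWst
  -- By descent a `K`-basis of `W` can be chosen among the invariants. It still generates `M` and
  -- has at most as many elements as `z`, hence is algebraically independent.
  obtain ⟨b, hb, hbs, hbi⟩ := exists_linearIndependent K {w | w ∈ W ∧ ∀ g, ψ g w = w}
  rw [← hspan] at hbs
  have hbfin : b.Finite := by
    have hli : LinearIndependent K (fun x : b ↦ (⟨x, (hb x.2).1⟩ : W)) :=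
      LinearIndependent.of_comp W.subtype hbi
    exact Set.finite_coe_iff.mp hli.finite
  have hcard : Nat.card b ≤ Nat.card ι := by
    have := hbfin.to_subtype
    have := Fintype.ofFinite b
    have := Fintype.ofFinite ι
    have h1 : Module.finrank K (Submodule.span K (Set.range ((↑) : b → M))) = Fintype.card b :=
      finrank_span_eq_card hbi
    rw [Subtype.range_coe, hbs] at h1
    rw [Nat.card_eq_fintype_card, Nat.card_eq_fintype_card, ← h1]
    exact finrank_range_le_card z
  have := hbfin.to_subtype
  let e := Finite.equivFin b
  refine ⟨Nat.card b, fun i ↦ e.symm i, ?_, ?_⟩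
  all_goals
    have hr : Set.range (fun i ↦ (e.symm i : M)) = b := by
      rw [show (fun i ↦ (e.symm i : M)) = (↑) ∘ e.symm from rfl, e.symm.surjective.range_comp,
        Subtype.range_coe]
    have hgen' : IntermediateField.adjoin K b = ⊤ := by
      rw [eq_top_iff, ← hgen, IntermediateField.adjoin_le_iff]
      intro x hx
      have h1 : x ∈ Submodule.span K b := hbs ▸ Submodule.subset_span hx
      have h2 : Submodule.span K b ≤
          Subalgebra.toSubmodule (IntermediateField.adjoin K b).toSubalgebra :=
        Submodule.span_le.mpr (IntermediateField.subset_adjoin K b)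
      exact h2 h1
  · refine algebraicIndependent_of_natCard_le_trdeg (by rw [hr, hgen']) ?_
    refine le_trans ?_ htr
    simpa using hcard
  · rw [hr]
    exact MonoidHom.fixedField_eq_adjoin hφ hc (fun g x hx ↦ (hb hx).2 g) hgen'

end Compat

end FixedField


/-! ### Miyata's theorem -/

section Affine

open Polynomial

variable {k Ω G : Type*} [Field k] [Field Ω] [Algebra k Ω] [Group G]
  {φ : G →* (Ω ≃ₐ[k] Ω)} {L : IntermediateField k Ω} {x : Ω}

/-- Apply `g` to the coefficients and substitute the affine form of `g x`. Its leading coefficient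
is nonzero, as otherwise `g x`, and with it `x`, would lie in `L`. Hence the action preserves
degrees in `x`. -/
lemma exists_polynomial_aeval_eq_of_affine (hL : ∀ g, ∀ a ∈ L, φ g a ∈ L)
    (hx : Transcendental L x) (hgx : ∀ g, ∃ a ∈ L, ∃ b ∈ L, φ g x = a * x + b)
    (g : G) (p : L[X]) :
    ∃ q : L[X], q.natDegree = p.natDegree ∧ aeval x q = φ g (aeval x p) := by
  obtain ⟨a, ha, b, hb, hab⟩ := hgx g
  have ha0 : a ≠ 0 := by
    rintro rfl
    rw [zero_mul, zero_add] at hab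
    have h1 : x ∈ L := by
      have := hL g⁻¹ b hb
      rwa [← hab, ← AlgEquiv.mul_apply, ← map_mul, inv_mul_cancel, map_one] at this
    exact hx (isAlgebraic_algebraMap (⟨x, h1⟩ : L))
  let σ : L →+* L := ((φ g : Ω →+* Ω).comp (algebraMap L Ω)).codRestrict L.toSubfield
    fun c ↦ hL g c c.2
  let l : L[X] := C ⟨a, ha⟩ * X + C ⟨b, hb⟩
  have hl : l.natDegree = 1 := natDegree_linear (by simpa [Subtype.ext_iff] using ha0)
  refine ⟨(p.map σ).comp l, ?_, ?_⟩
  · rw [natDegree_comp, hl, mul_one, natDegree_map]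
  · have h2 : aeval x l = φ g x := by simp [l, hab, IntermediateField.algebraMap_apply]
    rw [aeval_comp, h2, aeval_def, eval₂_map, aeval_def, ← RingHom.coe_coe (φ g) , hom_eval₂]
    rfl

/-- Miyata's theorem: if `G` acts on `L(x)` by automorphisms which preserve `L` and are affine in
`x`, then `L(x)^G` is generated over `L^G` by one element. -/
theorem exists_fixedField_eq_adjoin_of_affine [Finite G] (hL : ∀ g, ∀ a ∈ L, φ g a ∈ L)
    (hx : Transcendental L x) (hgx : ∀ g, ∃ a ∈ L, ∃ b ∈ L, φ g x = a * x + b) :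
    ∃ f, (IntermediateField.adjoin L {x}).restrictScalars k ⊓ φ.fixedField =
      IntermediateField.adjoin k ((↑(L ⊓ φ.fixedField) : Set Ω) ∪ {f}) := by
  classical
  have := Fintype.ofFinite G
  have hinj : Function.Injective (aeval (R := L) x) := transcendental_iff_injective.mp hx
  choose T hTd hT using exists_polynomial_aeval_eq_of_affine hL hx hgx
  have hTmul : ∀ (y : Ω) (g : G), φ g (∏ h, φ h y) = ∏ h, φ h y := fun p g ↦ by
    rw [map_prod]
    exact Fintype.prod_equiv (Equiv.mulLeft g) _ _ fun h ↦ by simp [map_mul]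
  -- The norm of `X` is an invariant polynomial of positive degree. One of least positive degree,
  -- `f`, turns out to be the required generator.
  have hex : ∃ n, ∃ p : L[X], p.natDegree = n ∧ 0 < n ∧ ∀ g, φ g (aeval x p) = aeval x p := by
    have hne : ∀ g, T g X ≠ 0 := fun g h0 ↦ by
      have := hTd g X
      simp [h0] at this
    refine ⟨_, ∏ g, T g X, rfl, ?_, fun g ↦ ?_⟩
    · rw [natDegree_prod _ _ fun g _ ↦ hne g]
      simp [hTd, Fintype.card_pos]
    · simp only [map_prod, hT]
      rw [← map_prod]
      exact hTmul _ g
  obtain ⟨f, hfn, hfpos, hf⟩ := Nat.find_spec hex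
  have hmin : ∀ p : L[X], (∀ g, φ g (aeval x p) = aeval x p) → p.natDegree < f.natDegree →
      p.natDegree = 0 := fun p hp hlt ↦ by
    by_contra h0
    rw [hfn] at hlt
    exact Nat.find_min hex hlt ⟨p, rfl, Nat.pos_of_ne_zero h0, hp⟩
  rw [← hfn] at hfpos
  have hf0 : f ≠ 0 := fun h ↦ by simp [h] at hfpos
  set E := IntermediateField.adjoin k ((↑(L ⊓ φ.fixedField) : Set Ω) ∪ {aeval x f}) with hE
  have hconst : ∀ p : L[X], (∀ g, φ g (aeval x p) = aeval x p) → p.natDegree = 0 →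
      aeval x p ∈ E := fun p hp h0 ↦ by
    refine IntermediateField.subset_adjoin _ _ (Or.inl ⟨?_, MonoidHom.mem_fixedField.mpr hp⟩)
    rw [natDegree_eq_zero] at h0
    obtain ⟨c, rfl⟩ := h0
    simp [IntermediateField.algebraMap_apply]
  have hpoly : ∀ n, ∀ p : L[X], p.natDegree = n → (∀ g, φ g (aeval x p) = aeval x p) →
      aeval x p ∈ E := by
    intro n
    induction n using Nat.strong_induction_on with
    | _ n ih =>
      intro p hpn hp
      by_cases hp0 : p.natDegree = 0
      · exact hconst p hp hp0
      have hle : f.natDegree ≤ p.natDegree := by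
        by_contra hlt
        exact hp0 (hmin p hp (not_le.mp hlt))
      set q := p / f
      set r := p % f
      have hdiv : f * q + r = p := EuclideanDomain.div_add_mod p f
      have hr : r.natDegree < f.natDegree := natDegree_mod_lt p hfpos.ne'
      -- Applying `g` to `p = f * q + r` gives a second division of `p` by `f`, with remainder of
      -- the same degree; uniqueness of division makes the quotient invariant.
      have key : ∀ g, T g q = q := fun g ↦ by
        have h1 : f * T g q + T g r = p := by
          apply hinj
          rw [map_add, map_mul, hT, hT, ← hf g, ← map_mul, ← map_add, ← map_mul, ← map_add, hdiv,
            hp]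
        by_contra hne
        have h2 : f * (T g q - q) = r - T g r := by
          linear_combination h1 - hdiv
        have h3 := congrArg natDegree h2
        rw [natDegree_mul hf0 (sub_ne_zero.mpr hne)] at h3
        have h4 := natDegree_sub_le r (T g r)
        rw [hTd, max_self] at h4
        omega
      have hq : ∀ g, φ g (aeval x q) = aeval x q := fun g ↦ by rw [← hT, key]
      have hrinv : ∀ g, φ g (aeval x r) = aeval x r := fun g ↦ by
        have h1 : aeval x r = aeval x p - aeval x f * aeval x q := by
          rw [← hdiv]; simp
        rw [h1, map_sub, map_mul, hp, hf, hq]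
      have hqlt : q.natDegree < n := by
        by_cases hq0 : q = 0
        · rw [hq0, natDegree_zero]
          omega
        · have h1 : (f * q).natDegree = f.natDegree + q.natDegree := natDegree_mul hf0 hq0
          have h2 : (f * q + r).natDegree = (f * q).natDegree :=
            natDegree_add_eq_left_of_natDegree_lt (by omega)
          rw [hdiv] at h2
          omega
      rw [← hdiv, map_add, map_mul]
      exact add_mem (mul_mem (IntermediateField.subset_adjoin _ _ (Or.inr rfl))
        (ih _ hqlt q rfl hq)) (hconst r hrinv (hmin r hrinv hr))
  refine ⟨aeval x f, le_antisymm ?_ ?_⟩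
  · rintro y ⟨hy1, hy2⟩
    replace hy2 := MonoidHom.mem_fixedField.mp hy2
    obtain ⟨p, q, rfl⟩ := (IntermediateField.mem_adjoin_simple_iff L y).mp hy1
    by_cases hq0 : aeval x q = 0
    · simp [hq0]
    -- Multiplying by the other conjugates of `q` turns the denominator into its norm, an invariant
    -- polynomial. The numerator is then invariant too, so polynomials suffice.
    have hden : aeval x (∏ g, T g q) ∈ E :=
      hpoly _ _ rfl fun g ↦ by
        simp only [map_prod, hT]
        rw [← map_prod]
        exact hTmul _ g
    have hprod : aeval x (∏ g, T g q) = aeval x q * aeval x (∏ g ∈ Finset.univ.erase 1, T g q) := by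
      rw [← map_mul]
      congr 1
      rw [← Finset.mul_prod_erase _ _ (Finset.mem_univ (1 : G))]
      congr 1
      apply hinj
      rw [hT]
      simp
    have hne : aeval x (∏ g, T g q) ≠ 0 := by
      rw [map_prod, Finset.prod_ne_zero_iff]
      intro g _
      rw [hT]
      simpa using hq0
    have hnum : aeval x p / aeval x q * aeval x (∏ g, T g q) =
        aeval x (p * ∏ g ∈ Finset.univ.erase 1, T g q) := by
      rw [hprod, map_mul]
      field_simp
    have hnumE : aeval x (p * ∏ g ∈ Finset.univ.erase 1, T g q) ∈ E :=
      hpoly _ _ rfl fun g ↦ by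
        rw [← hnum, map_mul, hy2]
        congr 1
        simp only [map_prod, hT]
        rw [← map_prod]
        exact hTmul _ g
    rw [← mul_div_cancel_right₀ (aeval x p / aeval x q) hne, hnum]
    exact div_mem hnumE hden
  · rw [IntermediateField.adjoin_le_iff]
    rintro y (⟨hy1, hy2⟩ | rfl)
    · exact ⟨IntermediateField.algebraMap_mem _ (⟨y, hy1⟩ : L), hy2⟩
    · refine ⟨?_, MonoidHom.mem_fixedField.mpr hf⟩
      have h1 : aeval x f ∈ IntermediateField.adjoin L {x} :=
        IntermediateField.algebra_adjoin_le_adjoin L {x} (aeval_mem_adjoin_singleton L x)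
      exact h1

end Affine


/-! ### Purely transcendental and rational intermediate fields -/

section PurelyTranscendental

variable {k Ω Ω' : Type*} [Field k] [Field Ω] [Algebra k Ω] [Field Ω'] [Algebra k Ω']

/-- `E'` is purely transcendental of finite transcendence degree over `E`, inside `Ω`. -/
def IntermediateField.IsPurelyTranscendental (E E' : IntermediateField k Ω) : Prop :=
  ∃ (r : ℕ) (t : Fin r → Ω), AlgebraicIndependent E t ∧
    E' = (IntermediateField.adjoin E (Set.range t)).restrictScalars k

/-- `E` is purely transcendental of finite transcendence degree over the base field. -/
def IntermediateField.IsRational (E : IntermediateField k Ω) : Prop :=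
  ∃ (r : ℕ) (t : Fin r → Ω), AlgebraicIndependent k t ∧
    E = IntermediateField.adjoin k (Set.range t)

lemma IntermediateField.IsRational.of_finite {E : IntermediateField k Ω} {ι : Type*} [Finite ι]
    {t : ι → Ω} (ht : AlgebraicIndependent k t)
    (hE : E = IntermediateField.adjoin k (Set.range t)) : E.IsRational := by
  let e := Finite.equivFin ι
  refine ⟨_, t ∘ e.symm, ht.comp _ e.symm.injective, ?_⟩
  rw [e.symm.surjective.range_comp, hE]

lemma IntermediateField.IsRational.trans {E E' : IntermediateField k Ω} (hE : E.IsRational)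
    (h : E.IsPurelyTranscendental E') : E'.IsRational := by
  obtain ⟨r, s, hs, hEs⟩ := hE
  obtain ⟨m, t, ht, rfl⟩ := h
  refine .of_finite (t := Sum.elim t s) (hs.sumElim_of_tower (S := E) ?_ ht) ?_
  · rintro _ ⟨i, rfl⟩
    exact ⟨⟨s i, hEs ▸ IntermediateField.subset_adjoin _ _ ⟨i, rfl⟩⟩, rfl⟩
  · rw [IntermediateField.restrictScalars_adjoin_eq_sup, Set.Sum.elim_range,
      IntermediateField.adjoin_union, ← hEs, sup_comm]

lemma IntermediateField.IsRational.map {E : IntermediateField k Ω} (hE : E.IsRational)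
    (f : Ω →ₐ[k] Ω') : (E.map f).IsRational := by
  obtain ⟨r, s, hs, rfl⟩ := hE
  exact ⟨r, f ∘ s, hs.map' f.injective, by
    rw [IntermediateField.adjoin_map, Set.range_comp]⟩

/-- The no-name lemma treats the lower field as an abstract field with a map to `Ω`; here its
conclusion becomes one about intermediate fields of `Ω`, where extensions can be composed. -/
lemma IntermediateField.IsPurelyTranscendental.of_algHom {E : IntermediateField k Ω'}
    [Algebra Ω' Ω] [IsScalarTower k Ω' Ω] {E' : IntermediateField k Ω} {r : ℕ} {t : Fin r → Ω}
    (ht : AlgebraicIndependent Ω' t)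
    (h : E' = (IntermediateField.adjoin E (Set.range t)).restrictScalars k) :
    (E.map (IsScalarTower.toAlgHom k Ω' Ω)).IsPurelyTranscendental E' := by
  refine ⟨r, t, ?_, ?_⟩
  · have h1 : AlgebraicIndependent E t := ht.restrictScalars (algebraMap E Ω').injective
    exact h1.ringHom_of_comp_eq (S := E.map (IsScalarTower.toAlgHom k Ω' Ω))
      (E.equivMap (IsScalarTower.toAlgHom k Ω' Ω)) (RingHom.id Ω)
      (AlgEquiv.surjective _) Function.injective_id rfl
  · rw [h, IntermediateField.restrictScalars_adjoin]
    apply le_antisymm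
    · intro x (hx : x ∈ IntermediateField.adjoin E (Set.range t))
      induction hx using IntermediateField.adjoin_induction with
      | mem x hx => exact IntermediateField.subset_adjoin _ _ (Or.inr hx)
      | algebraMap a => exact IntermediateField.subset_adjoin _ _ (Or.inl ⟨a, a.2, rfl⟩)
      | add x y _ _ hx hy => exact add_mem hx hy
      | mul x y _ _ hx hy => exact mul_mem hx hy
      | inv x _ hx => exact inv_mem hx
    · rw [IntermediateField.adjoin_le_iff]
      rintro x (⟨a, ha, rfl⟩ | hx)
      · exact IntermediateField.algebraMap_mem (IntermediateField.adjoin E (Set.range t))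
          (⟨a, ha⟩ : E)
      · exact IntermediateField.subset_adjoin E _ hx

end PurelyTranscendental

/-! ### The function field k(V) -/

/-- The field of fractions `k(V)` of the symmetric algebra of `V`. -/
def SymmetricField (k V : Type*) [Field k] [AddCommGroup V] [Module k V] : Type _ :=
  FractionRing (SymmetricAlgebra k V)

namespace SymmetricField

section

variable (k V : Type*) [Field k] [AddCommGroup V] [Module k V]

noncomputable instance : Field (SymmetricField k V) :=
  inferInstanceAs (Field (FractionRing (SymmetricAlgebra k V)))

noncomputable instance : Algebra (SymmetricAlgebra k V) (SymmetricField k V) :=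
  inferInstanceAs (Algebra (SymmetricAlgebra k V) (FractionRing (SymmetricAlgebra k V)))

noncomputable instance : Algebra k (SymmetricField k V) :=
  inferInstanceAs (Algebra k (FractionRing (SymmetricAlgebra k V)))

instance : IsScalarTower k (SymmetricAlgebra k V) (SymmetricField k V) :=
  inferInstanceAs (IsScalarTower k (SymmetricAlgebra k V) (FractionRing (SymmetricAlgebra k V)))

instance : IsFractionRing (SymmetricAlgebra k V) (SymmetricField k V) :=
  inferInstanceAs (IsFractionRing (SymmetricAlgebra k V) (FractionRing (SymmetricAlgebra k V)))

/-- The inclusion of `V` in `k(V)`. -/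
noncomputable def ι : V →ₗ[k] SymmetricField k V :=
  (IsScalarTower.toAlgHom k (SymmetricAlgebra k V) (SymmetricField k V)).toLinearMap ∘ₗ
    SymmetricAlgebra.ι k V

end

variable {k V W L : Type*} [Field k] [AddCommGroup V] [Module k V] [AddCommGroup W] [Module k W]
  [Field L] [Algebra k L]

lemma algebraMap_ι (v : V) :
    algebraMap (SymmetricAlgebra k V) (SymmetricField k V) (SymmetricAlgebra.ι k V v) = ι k V v :=
  rfl

lemma adjoin_range_ι : IntermediateField.adjoin k (Set.range (ι k V)) = ⊤ := by
  rw [eq_top_iff]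
  rintro x -
  have h : ∀ p : SymmetricAlgebra k V, algebraMap _ (SymmetricField k V) p ∈
      IntermediateField.adjoin k (Set.range (ι k V)) := fun p ↦ by
    induction p using SymmetricAlgebra.induction with
    | algebraMap a =>
      rw [← IsScalarTower.algebraMap_apply]
      exact IntermediateField.algebraMap_mem _ _
    | ι v => exact IntermediateField.subset_adjoin _ _ ⟨v, rfl⟩
    | mul a b ha hb => rw [map_mul]; exact mul_mem ha hb
    | add a b ha hb => rw [map_add]; exact add_mem ha hb
  obtain ⟨p, q, -, rfl⟩ := IsFractionRing.div_surjective (SymmetricAlgebra k V) x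
  exact div_mem (h p) (h q)

lemma adjoin_image_ι_span (s : Set V) :
    IntermediateField.adjoin k (ι k V '' s) =
      IntermediateField.adjoin k (ι k V '' (Submodule.span k s : Submodule k V)) := by
  refine le_antisymm (IntermediateField.adjoin.mono _ _ _
    (Set.image_mono Submodule.subset_span)) ?_
  rw [IntermediateField.adjoin_le_iff]
  rintro _ ⟨v, hv, rfl⟩
  have h : Submodule.span k s ≤ (Subalgebra.toSubmodule
      (IntermediateField.adjoin k (ι k V '' s)).toSubalgebra).comap (ι k V) :=
    Submodule.span_le.mpr fun w hw ↦ IntermediateField.subset_adjoin _ _ ⟨w, hw, rfl⟩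
  exact h hv

lemma adjoin_range_basis {κ : Type*} (b : Module.Basis κ k V) :
    IntermediateField.adjoin k (Set.range (ι k V ∘ b)) = ⊤ := by
  rw [Set.range_comp, adjoin_image_ι_span, b.span_eq, Submodule.top_coe, Set.image_univ,
    adjoin_range_ι]

lemma algHom_ext {f g : SymmetricField k V →ₐ[k] L} (h : ∀ v, f (ι k V v) = g (ι k V v)) :
    f = g := by
  ext x
  have hx : x ∈ IntermediateField.adjoin k (Set.range (ι k V)) :=
    adjoin_range_ι (k := k) (V := V) ▸ IntermediateField.mem_top
  induction hx using IntermediateField.adjoin_induction with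
  | mem x hx => obtain ⟨v, rfl⟩ := hx; exact h v
  | algebraMap a => simp
  | add x y _ _ hx hy => simp [hx, hy]
  | mul x y _ _ hx hy => simp [hx, hy]
  | inv x _ hx => simp [hx]

lemma algebraicIndependent_of_linearIndependent {κ : Type*} {v : κ → V}
    (hv : LinearIndependent k v) : AlgebraicIndependent k (ι k V ∘ v) := by
  have hb : ∀ {κ' : Type _} (b : Module.Basis κ' k V), AlgebraicIndependent k (ι k V ∘ b) := by
    intro κ' b
    have h1 : AlgebraicIndependent k (SymmetricAlgebra.ι k V ∘ b) := by
      rw [algebraicIndependent_iff_injective_aeval]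
      exact (SymmetricAlgebra.equivMvPolynomial b).symm.injective
    exact h1.map' (f := IsScalarTower.toAlgHom k (SymmetricAlgebra k V) (SymmetricField k V))
      (IsFractionRing.injective _ _)
  have h := (hb (Module.Basis.extend hv.linearIndepOn_id)).comp
    (fun i ↦ ⟨v i, Module.Basis.subset_extend _ ⟨i, rfl⟩⟩)
    (fun i j hij ↦ hv.injective congr(($hij : V)))
  simpa [Function.comp_def] using h

lemma trdeg_eq [FiniteDimensional k V] :
    Algebra.trdeg k (SymmetricField k V) = Module.finrank k V := by
  let b := Module.finBasis k V
  have h : IsTranscendenceBasis k (ι k V ∘ b) := by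
    rw [AlgebraicIndependent.isTranscendenceBasis_iff_isAlgebraic
      (algebraicIndependent_of_linearIndependent b.linearIndependent)]
    exact isAlgebraic_of_adjoin_eq_top (adjoin_range_basis b)
  have := h.lift_cardinalMk_eq_trdeg
  simpa using this.symm

/-- An injective linear map `V → W` induces an embedding `k(V) → k(W)`. -/
noncomputable def map (f : V →ₗ[k] W) (hf : Function.Injective f) :
    SymmetricField k V →ₐ[k] SymmetricField k W :=
  IsFractionRing.liftAlgHom (A := SymmetricAlgebra k V)
    (g := (IsScalarTower.toAlgHom k (SymmetricAlgebra k W) (SymmetricField k W)).comp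
      (SymmetricAlgebra.lift (SymmetricAlgebra.ι k W ∘ₗ f))) <| by
    -- A linear left inverse of `f` induces a left inverse on symmetric algebras, so the map there
    -- is injective and extends to fractions.
    obtain ⟨g, hg⟩ := f.exists_leftInverse_of_injective (LinearMap.ker_eq_bot.mpr hf)
    refine (IsFractionRing.injective (SymmetricAlgebra k W) _).comp ?_
    have h : (SymmetricAlgebra.lift (SymmetricAlgebra.ι k V ∘ₗ g)).comp
        (SymmetricAlgebra.lift (SymmetricAlgebra.ι k W ∘ₗ f)) = AlgHom.id k _ := by
      ext v
      simpa using congr(SymmetricAlgebra.ι k V ($hg v))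
    exact Function.LeftInverse.injective (DFunLike.congr_fun h)

@[simp]
lemma map_ι (f : V →ₗ[k] W) (hf : Function.Injective f) (v : V) :
    map f hf (ι k V v) = ι k W (f v) := by
  rw [← algebraMap_ι, map, IsFractionRing.liftAlgHom_apply, IsFractionRing.lift_algebraMap]
  simp [algebraMap_ι]

end SymmetricField


/-! ### Group actions on k(V) -/

section FixedField

variable {k K G : Type*} [Field k] [Field K] [Algebra k K] [Group G]

lemma MonoidHom.isAlgebraic_fixedField [Finite G] (φ : G →* (K ≃ₐ[k] K)) :
    Algebra.IsAlgebraic φ.fixedField K := by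
  have : Finite φ.range := Finite.of_surjective _ φ.rangeRestrict_surjective
  have : FiniteDimensional φ.fixedField K :=
    inferInstanceAs (FiniteDimensional (FixedPoints.subfield φ.range K) K)
  infer_instance

lemma MonoidHom.trdeg_fixedField [Finite G] (φ : G →* (K ≃ₐ[k] K)) :
    Algebra.trdeg k φ.fixedField = Algebra.trdeg k K := by
  have := φ.isAlgebraic_fixedField
  rw [← trdeg_add_eq k φ.fixedField (A := K), trdeg_eq_zero (R := φ.fixedField), add_zero]

/-- A quotient `P` of `G` acts on the field fixed by the kernel of `G → P`. -/
lemma MonoidHom.exists_action_fixedField_ker {P : Type*} [Group P] (φ : G →* (K ≃ₐ[k] K))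
    (π : G →* P) (hπ : Function.Surjective π) :
    ∃ ψ : P →* ((φ.comp π.ker.subtype).fixedField ≃ₐ[k] (φ.comp π.ker.subtype).fixedField),
      ∀ g x, (ψ (π g) x : K) = φ g x := by
  set E := (φ.comp π.ker.subtype).fixedField
  have hE : ∀ g, ∀ x ∈ E, φ g x ∈ E := fun g x hx ↦ by
    rw [MonoidHom.mem_fixedField] at hx ⊢
    rintro ⟨n, hn⟩
    have h := hx ⟨g⁻¹ * n * g, by simpa using π.normal_ker.conj_mem n hn g⁻¹⟩
    change φ n (φ g x) = φ g x
    conv_rhs => rw [← h]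
    simp [map_mul]
  let χ : G →* (E →ₐ[k] E) :=
    { toFun g := ((φ g : K →ₐ[k] K).comp E.val).codRestrict E.toSubalgebra fun x ↦ hE g x x.2
      map_one' := AlgHom.ext fun x ↦ Subtype.ext (by change φ 1 (x : K) = x; simp)
      map_mul' g h := AlgHom.ext fun x ↦ Subtype.ext (by
        change φ (g * h) (x : K) = φ g (φ h x); simp) }
  let χ' : G →* (E ≃ₐ[k] E) := (AlgEquiv.algHomUnitsEquiv k E).toMonoidHom.comp χ.toHomUnits
  have hχ : ∀ g x, (χ' g x : K) = φ g x := fun g x ↦ rfl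
  have hker : π.ker ≤ χ'.ker := fun n hn ↦ by
    ext x
    rw [hχ]
    exact MonoidHom.mem_fixedField.mp x.2 ⟨n, hn⟩
  refine ⟨π.liftOfSurjective hπ ⟨χ', hker⟩, fun g x ↦ ?_⟩
  rw [← hχ]
  congr 2
  exact MonoidHom.liftOfRightInverse_comp_apply _ _ _ _ _

end FixedField

section Representation

variable {k G V W : Type*} [Field k] [Group G] [AddCommGroup V] [Module k V]
  [AddCommGroup W] [Module k W]

lemma Representation.apply_injective (ρ : Representation k G V) (g : G) :
    Function.Injective (ρ g) :=
  Function.LeftInverse.injective (g := ρ g⁻¹) fun v ↦ by simp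

/-- The action of `G` on `k(V)` by field automorphisms induced by a representation on `V`. -/
noncomputable def Representation.fieldAct (ρ : Representation k G V) :
    G →* (SymmetricField k V ≃ₐ[k] SymmetricField k V) :=
  (AlgEquiv.algHomUnitsEquiv k (SymmetricField k V)).toMonoidHom.comp <| MonoidHom.toHomUnits
    { toFun g := SymmetricField.map (ρ g) (ρ.apply_injective g)
      map_one' := SymmetricField.algHom_ext fun v ↦ by simp
      map_mul' g h := SymmetricField.algHom_ext fun v ↦ by simp }

@[simp]
lemma Representation.fieldAct_ι (ρ : Representation k G V) (g : G) (v : V) :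
    ρ.fieldAct g (SymmetricField.ι k V v) = SymmetricField.ι k V (ρ g v) :=
  SymmetricField.map_ι _ (ρ.apply_injective g) v

lemma SymmetricField.ι_injective : Function.Injective (SymmetricField.ι k V) := by
  rw [← LinearMap.ker_eq_bot, LinearMap.ker_eq_bot']
  intro v hv
  by_contra hv0
  exact (SymmetricField.algebraicIndependent_of_linearIndependent (k := k)
    (LinearIndependent.of_subsingleton (v := fun _ : Unit ↦ v) () hv0)).ne_zero () hv

lemma Representation.fieldAct_injective {ρ : Representation k G V} (hρ : Function.Injective ρ) :
    Function.Injective ρ.fieldAct := fun g h hgh ↦ hρ <| by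
  ext v
  apply SymmetricField.ι_injective (k := k)
  rw [← Representation.fieldAct_ι, hgh, Representation.fieldAct_ι]

lemma Representation.fieldAct_map_of_eq {H : Type*} [Group H] (ρ : Representation k G V)
    (σ : Representation k H W) {f f' : V →ₗ[k] W} (hf : Function.Injective f)
    (hf' : Function.Injective f') {g : G} {h : H} (hfe : ∀ v, f' (ρ g v) = σ h (f v))
    (x : SymmetricField k V) :
    σ.fieldAct h (SymmetricField.map f hf x) = SymmetricField.map f' hf' (ρ.fieldAct g x) := by
  have h : (σ.fieldAct h : SymmetricField k W →ₐ[k] SymmetricField k W).comp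
      (SymmetricField.map f hf) = (SymmetricField.map f' hf').comp
        (ρ.fieldAct g : SymmetricField k V →ₐ[k] SymmetricField k V) :=
    SymmetricField.algHom_ext fun v ↦ by simp [hfe]
  exact DFunLike.congr_fun h x

lemma Representation.fieldAct_map (ρ : Representation k G V) (σ : Representation k G W)
    {f : V →ₗ[k] W} (hf : Function.Injective f) (hfe : ∀ g v, f (ρ g v) = σ g (f v))
    (g : G) (x : SymmetricField k V) :
    σ.fieldAct g (SymmetricField.map f hf x) = SymmetricField.map f hf (ρ.fieldAct g x) :=
  ρ.fieldAct_map_of_eq σ hf hf (hfe g) x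

end Representation

/-! ### The no-name lemma for representations -/

section NoName

variable {k : Type u} [Field k]

/-- If `W` is the direct sum of two representations, the first one faithful, then `k(W)^G` is
purely transcendental over `k(V)^G`. -/
theorem Representation.isPurelyTranscendental_fixedField {G : Type*} [Group G] [Finite G]
    {V U W : Type u} [AddCommGroup V] [Module k V] [AddCommGroup U] [Module k U] [AddCommGroup W]
    [Module k W] [FiniteDimensional k V] [FiniteDimensional k U] [FiniteDimensional k W]
    {ρ : Representation k G V} {τ : Representation k G U} {σ : Representation k G W}
    (hρ : Function.Injective ρ)
    {f : V →ₗ[k] W} (hf : Function.Injective f) (hfe : ∀ g v, f (ρ g v) = σ g (f v))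
    {h : U →ₗ[k] W} (hhe : ∀ g u, h (τ g u) = σ g (h u))
    (hfh : f.range ⊔ h.range = ⊤)
    (hd : Module.finrank k V + Module.finrank k U = Module.finrank k W) :
    (ρ.fieldAct.fixedField.map (SymmetricField.map f hf)).IsPurelyTranscendental
      σ.fieldAct.fixedField := by
  let _ : Algebra (SymmetricField k V) (SymmetricField k W) :=
    (SymmetricField.map f hf).toRingHom.toAlgebra
  have : IsScalarTower k (SymmetricField k V) (SymmetricField k W) :=
    IsScalarTower.of_algebraMap_eq fun x ↦ ((SymmetricField.map f hf).commutes x).symm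
  have hmap : ∀ x, algebraMap (SymmetricField k V) (SymmetricField k W) x =
    SymmetricField.map f hf x := fun _ ↦ rfl
  let b := Module.finBasis k U
  have hspan : ∀ u, SymmetricField.ι k W (h u) ∈ Submodule.span (SymmetricField k V)
      (Set.range (SymmetricField.ι k W ∘ h ∘ b)) := fun u ↦ by
    rw [← b.sum_repr u, map_sum, map_sum]
    refine Submodule.sum_mem _ fun i _ ↦ ?_
    rw [map_smul, map_smul, ← algebraMap_smul (SymmetricField k V)]
    exact Submodule.smul_mem _ _ (Submodule.subset_span ⟨i, rfl⟩)
  have hgen : IntermediateField.adjoin (SymmetricField k V)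
      (Set.range (SymmetricField.ι k W ∘ h ∘ b)) = ⊤ := by
    rw [eq_top_iff]
    rintro x -
    have hx : x ∈ IntermediateField.adjoin k (Set.range (SymmetricField.ι k W)) :=
      SymmetricField.adjoin_range_ι (k := k) (V := W) ▸ IntermediateField.mem_top
    refine (IntermediateField.adjoin_le_iff (F := k) (T := IntermediateField.restrictScalars k
      (IntermediateField.adjoin (SymmetricField k V)
        (Set.range (SymmetricField.ι k W ∘ h ∘ b))))).mpr ?_ hx
    rintro _ ⟨w, rfl⟩
    obtain ⟨_, ⟨v, rfl⟩, _, ⟨u, rfl⟩, rfl⟩ := Submodule.mem_sup.mp (hfh ▸ Submodule.mem_top : w ∈ _)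
    rw [map_add]
    refine add_mem ?_ ?_
    · rw [← SymmetricField.map_ι f hf v, ← hmap]
      exact IntermediateField.algebraMap_mem
        (IntermediateField.adjoin (SymmetricField k V) (Set.range (SymmetricField.ι k W ∘ h ∘ b))) _
    · have h2 : Submodule.span (SymmetricField k V) (Set.range (SymmetricField.ι k W ∘ h ∘ b)) ≤
          Subalgebra.toSubmodule (IntermediateField.adjoin (SymmetricField k V)
            (Set.range (SymmetricField.ι k W ∘ h ∘ b))).toSubalgebra :=
        Submodule.span_le.mpr (IntermediateField.subset_adjoin _ _)
      exact h2 (hspan u)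
  have htr : (Nat.card (Fin (Module.finrank k U)) : Cardinal) ≤
      Algebra.trdeg (SymmetricField k V) (SymmetricField k W) := by
    have h2 := trdeg_add_eq k (SymmetricField k V) (A := SymmetricField k W)
    rw [SymmetricField.trdeg_eq, SymmetricField.trdeg_eq, ← hd, Nat.cast_add] at h2
    rw [Cardinal.eq_of_add_eq_add_left h2 Cardinal.natCast_lt_aleph0]
    simp
  obtain ⟨r, t, ht, h1⟩ := MonoidHom.exists_fixedField_eq_adjoin_of_span
    (φ := ρ.fieldAct) (ψ := σ.fieldAct) (Representation.fieldAct_injective hρ)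
    (fun g a ↦ Representation.fieldAct_map ρ σ hf hfe g a)
    (SymmetricField.ι k W ∘ h ∘ b) hgen htr fun g i ↦ by
      simp only [Function.comp_apply, Representation.fieldAct_ι, ← hhe]
      exact hspan _
  exact .of_algHom ht h1

/-- `G` has a faithful finite-dimensional representation with rational field of invariants. -/
def HasRationalInvariants (k : Type u) [Field k] (G : Type*) [Group G] : Prop :=
  ∃ (V : Type u) (_ : AddCommGroup V) (_ : Module k V) (ρ : Representation k G V),
    FiniteDimensional k V ∧ Function.Injective ρ ∧ ρ.fieldAct.fixedField.IsRational

lemma HasRationalInvariants.of_mulEquiv {G H : Type*} [Group G] [Group H]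
    (hG : HasRationalInvariants k G) (e : G ≃* H) : HasRationalInvariants k H := by
  obtain ⟨V, _, _, ρ, hfd, hρ, hr⟩ := hG
  refine ⟨V, _, _, ρ.comp e.symm.toMonoidHom, hfd, hρ.comp e.symm.injective, ?_⟩
  convert hr using 1
  ext x
  simp only [MonoidHom.mem_fixedField]
  exact e.symm.surjective.forall (p := fun g ↦ ρ.fieldAct g x = x) |>.symm

end NoName


/-! ### Passing rationality from a quotient group to an extension -/

section Quotient

variable {k : Type u} [Field k]

/-- If the invariants of the kernel of `Γ → P` are generated by algebraically independent elements
whose span is stable, then rationality of invariants passes from `P` to `Γ`. -/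
theorem HasRationalInvariants.of_ker {Γ P : Type*} [Group Γ] [Group P] [Finite Γ]
    (hP : HasRationalInvariants k P) {π : Γ →* P} (hπ : Function.Surjective π)
    {V : Type u} [AddCommGroup V] [Module k V] [FiniteDimensional k V] (ρ : Representation k Γ V)
    (hρ : ∀ g ∈ π.ker, ρ g = 1 → g = 1) {κ : Type*} [Finite κ] (x : κ → SymmetricField k V)
    (hcard : Nat.card κ ≤ Module.finrank k V)
    (hx : (ρ.fieldAct.comp π.ker.subtype).fixedField = IntermediateField.adjoin k (Set.range x))
    (hst : ∀ g i, ρ.fieldAct g (x i) ∈ Submodule.span k (Set.range x)) :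
    HasRationalInvariants k Γ := by
  obtain ⟨U, _, _, τ, hfd, hτ, hr⟩ := hP
  have : Finite P := Finite.of_surjective _ hπ
  let σ : Representation k Γ (V × U) := ρ.prod (τ.comp π)
  have hσ : Function.Injective σ := by
    rw [injective_iff_map_eq_one]
    intro g hg
    have h1 : ∀ v u, (ρ g v, τ (π g) u) = (v, u) := fun v u ↦ congr($hg (v, u))
    have h2 : π g = 1 := hτ (by ext u; simpa using congr(($(h1 0 u)).2))
    exact hρ g h2 (by ext v; simpa using congr(($(h1 v 0)).1))
  refine ⟨V × U, _, _, σ, inferInstance, hσ, ?_⟩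
  set φ := σ.fieldAct with hφ
  have hl : Function.Injective (LinearMap.inl k V U) := LinearMap.inl_injective
  have hr' : Function.Injective (LinearMap.inr k V U) := LinearMap.inr_injective
  have hle : ∀ g a, φ g (SymmetricField.map _ hl a) = SymmetricField.map _ hl (ρ.fieldAct g a) :=
    Representation.fieldAct_map ρ σ hl fun g v ↦ by simp [σ]
  have hre : ∀ g a, φ g (SymmetricField.map _ hr' a) =
      SymmetricField.map _ hr' (τ.fieldAct (π g) a) :=
    Representation.fieldAct_map (τ.comp π) σ hr' fun g v ↦ by simp [σ]
  -- Let N be the kernel of `π`. As N is trivial on `U`, the field `E = k(V × U)^N` is k(U)(x). The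
  -- quotient `P` acts on it compatibly with its faithful action on k(U), and semilinearly on the
  -- span of `x`, so the no-name lemma applies to `E` over k(U).
  set E := (φ.comp π.ker.subtype).fixedField with hE
  obtain ⟨ψ, hψ⟩ : ∃ ψ : P →* (E ≃ₐ[k] E),
      ∀ g (y : E), (ψ (π g) y : SymmetricField k (V × U)) = φ g y :=
    MonoidHom.exists_action_fixedField_ker φ π hπ
  have hmemE : ∀ {y}, y ∈ E ↔ ∀ g ∈ π.ker, φ g y = y := fun {y} ↦ by
    simp [hE, MonoidHom.mem_fixedField]
  let j : SymmetricField k U →ₐ[k] E :=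
    (SymmetricField.map _ hr').codRestrict E.toSubalgebra fun y ↦ hmemE.mpr fun g hg ↦ by
      rw [hre, MonoidHom.mem_ker.mp hg]
      simp
  have hz : ∀ y ∈ IntermediateField.adjoin k (Set.range x), SymmetricField.map _ hl y ∈ E := by
    intro y hy
    rw [← hx, MonoidHom.mem_fixedField] at hy
    refine hmemE.mpr fun g hg ↦ ?_
    rw [hle]
    exact congrArg _ (hy ⟨g, hg⟩)
  let z : κ → E := fun i ↦
    ⟨SymmetricField.map _ hl (x i), hz _ (IntermediateField.subset_adjoin _ _ ⟨i, rfl⟩)⟩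
  let _ : Algebra (SymmetricField k U) E := j.toRingHom.toAlgebra
  have : IsScalarTower k (SymmetricField k U) E :=
    IsScalarTower.of_algebraMap_eq fun x ↦ (j.commutes x).symm
  have hj : ∀ y, ((algebraMap (SymmetricField k U) E y : E) : SymmetricField k (V × U)) =
    SymmetricField.map _ hr' y := fun _ ↦ rfl
  have hgen : IntermediateField.adjoin (SymmetricField k U) (Set.range z) = ⊤ := by
    set T := ((IntermediateField.adjoin (SymmetricField k U) (Set.range z)).restrictScalars k).map
      E.val with hT
    have hTj : ∀ y, SymmetricField.map _ hr' y ∈ T := fun y ↦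
      ⟨algebraMap (SymmetricField k U) E y, IntermediateField.algebraMap_mem
        (IntermediateField.adjoin (SymmetricField k U) (Set.range z)) y, rfl⟩
    have hTx : ∀ y ∈ IntermediateField.adjoin k (Set.range x), SymmetricField.map _ hl y ∈ T := by
      have h1 : IntermediateField.adjoin k (Set.range x) ≤ T.comap (SymmetricField.map _ hl) := by
        rw [IntermediateField.adjoin_le_iff]
        rintro _ ⟨i, rfl⟩
        exact ⟨z i, IntermediateField.subset_adjoin (SymmetricField k U) _ ⟨i, rfl⟩, rfl⟩
      exact fun y hy ↦ h1 hy
    let _ : Algebra (SymmetricField k V) (SymmetricField k (V × U)) :=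
      (SymmetricField.map _ hl).toRingHom.toAlgebra
    have : IsScalarTower k (SymmetricField k V) (SymmetricField k (V × U)) :=
      IsScalarTower.of_algebraMap_eq fun x ↦ ((SymmetricField.map _ hl).commutes x).symm
    -- The coordinates coming from `U` are N-invariant generators of k(V × U) over k(V), on which N
    -- acts faithfully; so `E` is generated by them over k(V)^N = k(x).
    have hET : E ≤ T := by
      rw [hE, MonoidHom.fixedField_eq_adjoin (φ := ρ.fieldAct.comp π.ker.subtype)
        (t := Set.range (SymmetricField.ι k (V × U) ∘ LinearMap.inr k V U)) ?_
        (fun g a ↦ hle g a) ?_ ?_]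
      · intro y hy
        replace hy : y ∈ IntermediateField.adjoin (ρ.fieldAct.comp π.ker.subtype).fixedField
          (Set.range (SymmetricField.ι k (V × U) ∘ LinearMap.inr k V U)) := hy
        induction hy using IntermediateField.adjoin_induction with
        | mem y hy =>
          obtain ⟨u, rfl⟩ := hy
          have := hTj (SymmetricField.ι k U u)
          rwa [SymmetricField.map_ι] at this
        | algebraMap a => exact hTx a (hx ▸ a.2)
        | add x y _ _ hx hy => exact add_mem hx hy
        | mul x y _ _ hx hy => exact mul_mem hx hy
        | inv x _ hx => exact inv_mem hx
      · rw [injective_iff_map_eq_one]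
        rintro ⟨g, hg⟩ h1
        refine Subtype.ext (hρ g hg ?_)
        ext v
        apply SymmetricField.ι_injective (k := k)
        rw [← Representation.fieldAct_ι]
        exact congr($h1 (SymmetricField.ι k V v))
      · rintro ⟨g, hg⟩ _ ⟨u, rfl⟩
        have := hre g (SymmetricField.ι k U u)
        rw [SymmetricField.map_ι, MonoidHom.mem_ker.mp hg] at this
        simpa using this
      · rw [eq_top_iff]
        rintro y -
        have hy : y ∈ IntermediateField.adjoin k (Set.range (SymmetricField.ι k (V × U))) :=
          SymmetricField.adjoin_range_ι (k := k) (V := V × U) ▸ IntermediateField.mem_top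
        refine (IntermediateField.adjoin_le_iff (F := k) (T := IntermediateField.restrictScalars k
          (IntermediateField.adjoin (SymmetricField k V) (Set.range
            (SymmetricField.ι k (V × U) ∘ LinearMap.inr k V U))))).mpr ?_ hy
        rintro _ ⟨⟨v, u⟩, rfl⟩
        rw [show (v, u) = LinearMap.inl k V U v + LinearMap.inr k V U u by simp, map_add]
        refine add_mem ?_ (IntermediateField.subset_adjoin (SymmetricField k V) _ ⟨u, rfl⟩)
        rw [← SymmetricField.map_ι _ hl]
        exact IntermediateField.algebraMap_mem (IntermediateField.adjoin (SymmetricField k V)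
          (Set.range (SymmetricField.ι k (V × U) ∘ LinearMap.inr k V U))) _
    rw [eq_top_iff]
    rintro ⟨y, hy⟩ -
    obtain ⟨y', hy', hyy⟩ := hET hy
    rwa [show (⟨y, hy⟩ : E) = y' from Subtype.ext hyy.symm]
  -- `E` has the transcendence degree dim V + dim U of k(V × U), which is algebraic over it;
  -- subtracting that of k(U) leaves dim V.
  have htr : (Nat.card κ : Cardinal) ≤ Algebra.trdeg (SymmetricField k U) E := by
    have h2 := trdeg_add_eq k (SymmetricField k U) (A := E)
    rw [SymmetricField.trdeg_eq, MonoidHom.trdeg_fixedField, SymmetricField.trdeg_eq,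
      Module.finrank_prod, add_comm (Module.finrank k V), Nat.cast_add] at h2
    rw [Cardinal.eq_of_add_eq_add_left h2 Cardinal.natCast_lt_aleph0]
    exact_mod_cast hcard
  obtain ⟨r, t, ht, h1⟩ := MonoidHom.exists_fixedField_eq_adjoin_of_span
    (φ := τ.fieldAct) (ψ := ψ) (Representation.fieldAct_injective hτ) (fun p a ↦ by
      obtain ⟨g, rfl⟩ := hπ p
      apply Subtype.ext
      rw [hψ, hj, hj, hre]) z hgen htr fun p i ↦ by
      obtain ⟨g, rfl⟩ := hπ p
      have h2 : Submodule.span k (Set.range x) ≤ (Subalgebra.toSubmodule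
          (IntermediateField.adjoin k (Set.range x)).toSubalgebra) :=
        Submodule.span_le.mpr (IntermediateField.subset_adjoin _ _)
      have h3 : ∀ y (hy : y ∈ Submodule.span k (Set.range x)),
          (⟨SymmetricField.map _ hl y, hz y (h2 hy)⟩ : E) ∈
            Submodule.span (SymmetricField k U) (Set.range z) := by
        intro y hy
        induction hy using Submodule.span_induction with
        | mem y hy =>
          obtain ⟨i, rfl⟩ := hy
          exact Submodule.subset_span ⟨i, rfl⟩
        | zero =>
          convert Submodule.zero_mem _
          exact map_zero _
        | add a b ha hb iha ihb =>
          convert Submodule.add_mem _ iha ihb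
          exact map_add _ _ _
        | smul c a ha iha =>
          convert Submodule.smul_mem _ (algebraMap k (SymmetricField k U) c) iha
          rw [algebraMap_smul]
          exact map_smul _ _ _
      convert h3 _ (hst g i)
      rw [hψ, ← hle]
  have h4 := (hr.map _).trans (IntermediateField.IsPurelyTranscendental.of_algHom ht h1)
  convert h4.map E.val
  ext y
  rw [MonoidHom.mem_fixedField]
  constructor
  · intro hy
    have hyE : y ∈ E := hmemE.mpr fun g _ ↦ hy g
    refine ⟨⟨y, hyE⟩, MonoidHom.mem_fixedField.mpr fun p ↦ ?_, rfl⟩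
    obtain ⟨g, rfl⟩ := hπ p
    apply Subtype.ext
    rw [hψ]
    exact hy g
  · rintro ⟨y', hy', rfl⟩ g
    have := MonoidHom.mem_fixedField.mp hy' (π g)
    change φ g (y' : SymmetricField k (V × U)) = y'
    rw [← hψ, this]

end Quotient


/-! ### Degree bounds for composita -/

section Degree

variable {k K K₀ : Type*} [Field k] [Field K] [Algebra k K] [Field K₀] [Algebra k K₀]

open scoped IntermediateField.algebraAdjoinAdjoin in
lemma AlgebraicIndependent.transcendental_intermediateField_adjoin {κ : Type*} {x : κ → K}
    (hx : AlgebraicIndependent k x) {s : Set κ} {i : κ} (hi : i ∉ s) :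
    Transcendental (IntermediateField.adjoin k (x '' s)) (x i) := by
  intro h
  exact hx.transcendental_adjoin hi
    ((IsFractionRing.isAlgebraic_iff (Algebra.adjoin k (x '' s))
      (IntermediateField.adjoin k (x '' s)) K).mpr h)

/-- Generators of `K₀` over `F` as a vector space still span the compositum over the larger base
`E`. It is applied to a copy of k(W) over k(W)^D. -/
lemma IntermediateField.rank_adjoin_range_le (j : K₀ →ₐ[k] K) {F : IntermediateField k K₀}
    {E : IntermediateField k K} (h : F.map j ≤ E) {n : ℕ} (hn : Module.rank F K₀ ≤ n) :
    Module.rank E (IntermediateField.adjoin E (Set.range j)) ≤ n := by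
  let _ : Algebra K₀ K := j.toRingHom.toAlgebra
  let i : F →+* E := (j.toRingHom.comp (algebraMap F K₀)).codRestrict E.toSubfield
    fun x ↦ h ⟨x, x.2, rfl⟩
  let _ : Algebra F E := i.toAlgebra
  have : IsScalarTower F E K := IsScalarTower.of_algebraMap_eq fun _ ↦ rfl
  let L : IntermediateField F K := (IsScalarTower.toAlgHom F K₀ K).fieldRange
  have e : K₀ ≃ₗ[F] L :=
    (AlgEquiv.ofInjectiveField (IsScalarTower.toAlgHom F K₀ K)).toLinearEquiv
  have hfd : FiniteDimensional F K₀ :=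
    Module.rank_lt_aleph0_iff.mp (hn.trans_lt Cardinal.natCast_lt_aleph0)
  have : FiniteDimensional F L := Module.Finite.equiv e
  have h1 := IntermediateField.adjoin_rank_le_of_isAlgebraic_right (E := E) L
  refine h1.trans ?_
  rw [← Module.finrank_eq_rank, Nat.cast_le] at hn ⊢
  rwa [← e.finrank_eq]

lemma IntermediateField.rank_le_pow_of_iSup_eq_top {κ : Type*} [Finite κ]
    (A : κ → IntermediateField k K) {n : ℕ} (hA : ∀ i, Module.rank k (A i) ≤ n)
    (htop : ⨆ i, A i = ⊤) : Module.rank k K ≤ (n ^ Nat.card κ : ℕ) := by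
  classical
  have := Fintype.ofFinite κ
  have hfd : ∀ i, FiniteDimensional k (A i) := fun i ↦
    Module.rank_lt_aleph0_iff.mp ((hA i).trans_lt Cardinal.natCast_lt_aleph0)
  have hfin : ∀ i, Module.finrank k (A i) ≤ n := fun i ↦ by
    have := hA i
    rwa [← Module.finrank_eq_rank, Nat.cast_le] at this
  have h1 : ∀ s : Finset κ, Module.finrank k (s.sup A : IntermediateField k K) ≤ n ^ s.card := by
    intro s
    induction s using Finset.induction_on with
    | empty => rw [show (∅ : Finset κ).sup A = ⊥ from Finset.sup_empty, IntermediateField.finrank_bot]; simp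
    | insert i s hi ih =>
      rw [Finset.sup_insert, Finset.card_insert_of_notMem hi, pow_succ']
      exact (IntermediateField.finrank_sup_le _ _).trans (Nat.mul_le_mul (hfin i) ih)
  have h2 : FiniteDimensional k (⨆ i, A i : IntermediateField k K) :=
    IntermediateField.finiteDimensional_iSup_of_finite
  have h3 := h1 Finset.univ
  rw [Finset.sup_univ_eq_iSup, htop, Finset.card_univ, ← Nat.card_eq_fintype_card] at h3
  rw [htop] at h2
  have e := (IntermediateField.topEquiv (F := k) (E := K)).toLinearEquiv
  have : FiniteDimensional k K := Module.Finite.equiv e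
  rw [← Module.finrank_eq_rank, Nat.cast_le, ← e.finrank_eq]
  exact h3

end Degree

/-! ### Lüroth's theorem and invariants of a plane -/

section Luroth

variable {k K : Type*} [Field k] [Field K] [Algebra k K]

/-- Lüroth's theorem for subfields of a simple transcendental extension. -/
lemma IntermediateField.exists_eq_adjoin_of_le_adjoin_simple {t : K} (ht : Transcendental k t)
    {E : IntermediateField k K} (hE : E ≤ IntermediateField.adjoin k {t}) :
    ∃ f, E = IntermediateField.adjoin k {f} := by
  let e := RatFunc.algEquivOfTranscendental t ht
  let j : RatFunc k →ₐ[k] K := (IntermediateField.adjoin k {t}).val.comp e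
  have hj : E = (E.comap j).map j := by
    refine le_antisymm (fun x hx ↦ ?_) (fun x hx ↦ ?_)
    · refine ⟨e.symm ⟨x, hE hx⟩, ?_, ?_⟩
      · change j _ ∈ E
        simpa [j] using hx
      · simp [j]
    · obtain ⟨y, hy, rfl⟩ := hx
      exact hy
  rw [hj, RatFunc.Luroth.eq_adjoin_generator (E := E.comap j), IntermediateField.adjoin_map,
    Set.image_singleton]
  exact ⟨_, rfl⟩

end Luroth

section Plane

variable {k D W : Type*} [Field k] [Group D] [Finite D] [AddCommGroup W] [Module k W]

/-- The invariants of a two-dimensional representation are generated by two elements. -/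
theorem Representation.exists_fixedField_eq_adjoin_pair (ρ : Representation k D W)
    (h2 : Module.finrank k W = 2) :
    ∃ x : Fin 2 → SymmetricField k W,
      ρ.fieldAct.fixedField = IntermediateField.adjoin k (Set.range x) := by
  have : FiniteDimensional k W := Module.finite_of_finrank_eq_succ h2
  let b := Module.finBasisOfFinrankEq k W h2
  set φ := ρ.fieldAct
  set y : Fin 2 → SymmetricField k W := SymmetricField.ι k W ∘ b
  have hy : AlgebraicIndependent k y :=
    SymmetricField.algebraicIndependent_of_linearIndependent b.linearIndependent
  have hy0 : y 0 ≠ 0 := hy.ne_zero 0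
  have hgy : ∀ g i, ∃ c d : k, φ g (y i) = algebraMap _ _ c * y 0 + algebraMap _ _ d * y 1 :=
    fun g i ↦ ⟨b.repr (ρ g (b i)) 0, b.repr (ρ g (b i)) 1, by
      have := b.sum_repr (ρ g (b i))
      rw [Fin.sum_univ_two] at this
      simp only [y, φ, Function.comp_apply, Representation.fieldAct_ι]
      nth_rw 1 [← this]
      simp [Algebra.smul_def]⟩
  -- The group acts on `L = k(t)` by fractional linear substitutions and sends `y 0` to an
  -- `L`-multiple of itself. Miyata gives one generator over the invariants of k(t), and Lüroth
  -- gives a single generator for these.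
  set t := y 1 / y 0
  have hyt : y 1 = t * y 0 := (div_mul_cancel₀ _ hy0).symm
  set L := IntermediateField.adjoin k {t}
  have htL : t ∈ L := IntermediateField.mem_adjoin_simple_self k t
  have hgL : ∀ g i, ∃ a ∈ L, φ g (y i) = a * y 0 := fun g i ↦ by
    obtain ⟨c, d, hcd⟩ := hgy g i
    refine ⟨algebraMap _ _ c + algebraMap _ _ d * t, add_mem (algebraMap_mem _ _)
      (mul_mem (algebraMap_mem _ _) htL), ?_⟩
    rw [hcd, hyt]
    ring
  have hLst : ∀ g, ∀ a ∈ L, φ g a ∈ L := fun g ↦ by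
    have : L ≤ L.comap (φ g : SymmetricField k W →ₐ[k] SymmetricField k W) := by
      rw [IntermediateField.adjoin_le_iff, Set.singleton_subset_iff]
      obtain ⟨a, ha, ha'⟩ := hgL g 0
      obtain ⟨c, hc, hc'⟩ := hgL g 1
      change φ g t ∈ L
      rw [map_div₀, ha', hc', mul_div_mul_right _ _ hy0]
      exact div_mem hc ha
    exact this
  have hgen : IntermediateField.adjoin k (Set.range ![t, y 0]) = ⊤ := by
    rw [eq_top_iff, ← SymmetricField.adjoin_range_basis b, IntermediateField.adjoin_le_iff]
    have h0 : y 0 ∈ IntermediateField.adjoin k (Set.range ![t, y 0]) :=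
      IntermediateField.subset_adjoin _ _ ⟨1, rfl⟩
    have ht : t ∈ IntermediateField.adjoin k (Set.range ![t, y 0]) :=
      IntermediateField.subset_adjoin _ _ ⟨0, rfl⟩
    rintro _ ⟨i, rfl⟩
    fin_cases i
    · exact h0
    · change y 1 ∈ _
      rw [hyt]
      exact mul_mem ht h0
  have hai : AlgebraicIndependent k ![t, y 0] :=
    algebraicIndependent_of_natCard_le_trdeg hgen (by rw [SymmetricField.trdeg_eq, h2]; simp)
  have htr : Transcendental L (y 0) := by
    have := hai.transcendental_intermediateField_adjoin (s := {0}) (i := 1) (by simp)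
    rwa [Set.image_singleton] at this
  obtain ⟨f, hf⟩ := exists_fixedField_eq_adjoin_of_affine (φ := φ) hLst htr fun g ↦ by
    obtain ⟨a, ha, h⟩ := hgL g 0
    exact ⟨a, ha, 0, zero_mem _, by rw [h, add_zero]⟩
  obtain ⟨f', hf'⟩ := IntermediateField.exists_eq_adjoin_of_le_adjoin_simple (hai.transcendental 0)
    (inf_le_left : L ⊓ φ.fixedField ≤ L)
  have htop : (IntermediateField.adjoin L {y 0}).restrictScalars k = ⊤ := by
    rw [eq_top_iff, ← hgen, IntermediateField.adjoin_le_iff, IntermediateField.restrictScalars_adjoin]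
    rintro _ ⟨i, rfl⟩
    fin_cases i
    · exact IntermediateField.subset_adjoin _ _ (Or.inl htL)
    · exact IntermediateField.subset_adjoin _ _ (Or.inr rfl)
  rw [htop, top_inf_eq, IntermediateField.adjoin_union, IntermediateField.adjoin_self, hf',
    ← IntermediateField.adjoin_union] at hf
  refine ⟨![f', f], ?_⟩
  rw [hf, Matrix.range_cons, Matrix.range_cons, Matrix.range_empty, Set.union_empty]

end Plane


/-! ### Wreath products and their invariants -/

section Wreath

/-- The action of `P` on `D^X` by permutation of the coordinates. -/
def permuteCoordinates (D P X : Type*) [Group D] [Group P] [MulAction P X] :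
    P →* MulAut (X → D) where
  toFun p :=
    { toFun f x := f (p⁻¹ • x)
      invFun f x := f (p • x)
      left_inv f := by ext x; simp
      right_inv f := by ext x; simp
      map_mul' f g := rfl }
  map_one' := by ext f x; simp
  map_mul' p q := by ext f x; simp [mul_smul]

/-- The wreath product of `D` with a group `P` acting on `X`. -/
abbrev WreathProduct (D P X : Type*) [Group D] [Group P] [MulAction P X] : Type _ :=
  (X → D) ⋊[permuteCoordinates D P X] P

variable {D P X : Type*} [Group D] [Group P] [MulAction P X]

instance [Finite D] [Finite P] [Finite X] : Finite (WreathProduct D P X) :=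
  Finite.of_equiv _ SemidirectProduct.equivProd.symm

lemma WreathProduct.natCard [Finite X] :
    Nat.card (WreathProduct D P X) = Nat.card D ^ Nat.card X * Nat.card P := by
  rw [Nat.card_congr SemidirectProduct.equivProd, Nat.card_prod, Nat.card_fun]

variable {k W : Type*} [Field k] [AddCommGroup W] [Module k W]

/-- The representation of a wreath product on `W^X` induced by a representation on `W`. -/
def Representation.wreath (δ : Representation k D W) (P X : Type*) [Group P] [MulAction P X] :
    Representation k (WreathProduct D P X) (X → W) where
  toFun g :=
    { toFun w x := δ (g.left x) (w (g.right⁻¹ • x))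
      map_add' w w' := by ext x; simp
      map_smul' c w := by ext x; simp }
  map_one' := by ext w x; simp
  map_mul' g h := by
    ext w x
    simp [permuteCoordinates, mul_smul]

lemma Representation.wreath_apply (δ : Representation k D W) (g : WreathProduct D P X)
    (w : X → W) (x : X) : δ.wreath P X g w x = δ (g.left x) (w (g.right⁻¹ • x)) :=
  rfl

lemma Representation.wreath_single [DecidableEq X] (δ : Representation k D W)
    (g : WreathProduct D P X) (x : X) (w : W) :
    δ.wreath P X g (LinearMap.single k (fun _ ↦ W) x w) =
      LinearMap.single k (fun _ ↦ W) (g.right • x) (δ (g.left (g.right • x)) w) := by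
  ext y
  rw [Representation.wreath_apply, LinearMap.single_apply, LinearMap.single_apply]
  by_cases h : y = g.right • x
  · subst h; simp
  · have h' : g.right⁻¹ • y ≠ x := fun h' ↦ h (by rw [← h', smul_inv_smul])
    simp [h, h']

lemma Representation.left_eq_one_of_wreath_eq_one {δ : Representation k D W}
    (hδ : Function.Injective δ) {g : WreathProduct D P X} (hg : g.right = 1)
    (h : δ.wreath P X g = 1) : g = 1 := by
  refine SemidirectProduct.ext (funext fun x ↦ hδ ?_) hg
  ext w
  have := congr($h (fun _ ↦ w) x)
  simpa [Representation.wreath_apply] using this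

end Wreath

section WreathInvariants

variable {k : Type u} [Field k]

/-- Rationality of invariants passes to wreath products with a group that has a faithful
two-dimensional representation. -/
theorem HasRationalInvariants.wreath {D P : Type*} {X : Type} [Group D] [Group P] [MulAction P X]
    [Finite D] [Finite P] [Finite X] {W : Type u} [AddCommGroup W] [Module k W]
    {δ : Representation k D W} (hδ : Function.Injective δ) (hW : Module.finrank k W = 2)
    (hP : HasRationalInvariants k P) : HasRationalInvariants k (WreathProduct D P X) := by
  classical
  have := Fintype.ofFinite X
  have : FiniteDimensional k W := Module.finite_of_finrank_eq_succ hW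
  obtain ⟨x, hx⟩ := δ.exists_fixedField_eq_adjoin_pair hW
  set ρ := δ.wreath P X
  have hs : ∀ i : X, Function.Injective (LinearMap.single k (fun _ ↦ W) i) :=
    fun i w w' h ↦ by simpa using congrFun h i
  let emb : X → SymmetricField k W →ₐ[k] SymmetricField k (X → W) := fun i ↦
    SymmetricField.map (LinearMap.single k (fun _ ↦ W) i) (hs i)
  have hemb : ∀ (g : WreathProduct D P X) i y, ρ.fieldAct g (emb i y) =
      emb (g.right • i) (δ.fieldAct (g.left (g.right • i)) y) := by
    intro g i y
    exact δ.fieldAct_map_of_eq ρ (hs i) (hs _) (fun w ↦ (δ.wreath_single g i w).symm) y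
  have hxinv : ∀ d j, δ.fieldAct d (x j) = x j := fun d j ↦
    MonoidHom.mem_fixedField.mp
      (hx ▸ IntermediateField.subset_adjoin _ _ ⟨j, rfl⟩ : x j ∈ δ.fieldAct.fixedField) d
  -- The two generators of k(W)^D, placed in each of the |X| copies of k(W): the base group D^X
  -- fixes them, `P` permutes them, and their number 2|X| is the dimension of W^X.
  let z : X × Fin 2 → SymmetricField k (X → W) := fun p ↦ emb p.1 (x p.2)
  have hz : ∀ g p, ρ.fieldAct g (z p) = z (g.right • p.1, p.2) := fun g p ↦ by
    simp only [z]
    rw [hemb, hxinv]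
  have hinj : Function.Injective (ρ.fieldAct.comp
      (SemidirectProduct.rightHom (φ := permuteCoordinates D P X)).ker.subtype) := by
    rw [injective_iff_map_eq_one]
    rintro ⟨g, hg⟩ h
    refine Subtype.ext (Representation.left_eq_one_of_wreath_eq_one hδ hg ?_)
    refine LinearMap.ext fun v ↦ ?_
    apply SymmetricField.ι_injective (k := k)
    rw [← Representation.fieldAct_ι]
    exact congr($h (SymmetricField.ι k (X → W) v))
  refine hP.of_ker (π := SemidirectProduct.rightHom) SemidirectProduct.rightHom_surjective
    ρ (fun g hg h ↦ Representation.left_eq_one_of_wreath_eq_one hδ hg h) z ?_ ?_ ?_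
  · rw [Module.finrank_pi_fintype]
    simp [hW, Nat.card_eq_fintype_card]
  · refine MonoidHom.eq_fixedField_of_rank_le hinj ?_ ?_
    · rw [IntermediateField.adjoin_le_iff]
      rintro _ ⟨p, rfl⟩
      refine MonoidHom.mem_fixedField.mpr fun g ↦ ?_
      have hg : g.1.right = 1 := g.2
      change ρ.fieldAct g.1 (z p) = z p
      rw [hz, hg, one_smul]
    · set E := IntermediateField.adjoin k (Set.range z)
      have hker : Nat.card (SemidirectProduct.rightHom (φ := permuteCoordinates D P X)).ker =
          Nat.card D ^ Nat.card X := by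
        rw [← SemidirectProduct.range_inl_eq_ker_rightHom,
          ← Nat.card_congr (MonoidHom.ofInjective SemidirectProduct.inl_injective).toEquiv,
          Nat.card_fun]
      rw [hker]
      -- Each copy of k(W) contributes degree at most |D| over k(z), and the copies together
      -- generate k(W^X); the resulting bound |D|^|X| is the order of the base group.
      refine IntermediateField.rank_le_pow_of_iSup_eq_top
        (fun i ↦ IntermediateField.adjoin E (Set.range (emb i))) (fun i ↦ ?_) ?_
      · refine IntermediateField.rank_adjoin_range_le (emb i) (F := δ.fieldAct.fixedField) ?_
          (δ.fieldAct.rank_fixedField (Representation.fieldAct_injective hδ)).le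
        rw [hx, IntermediateField.adjoin_map, IntermediateField.adjoin_le_iff]
        rintro _ ⟨_, ⟨j, rfl⟩, rfl⟩
        exact IntermediateField.subset_adjoin _ _ ⟨(i, j), rfl⟩
      · rw [← IntermediateField.restrictScalars_eq_top_iff (K := k), eq_top_iff,
          ← SymmetricField.adjoin_range_ι, IntermediateField.adjoin_le_iff]
        rintro _ ⟨v, rfl⟩
        rw [← LinearMap.sum_single_apply (fun _ ↦ W) v, map_sum]
        refine sum_mem fun i _ ↦ ?_
        have h1 : SymmetricField.ι k (X → W) (Pi.single i (v i)) =
            emb i (SymmetricField.ι k W (v i)) := by simp [emb]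
        rw [h1]
        exact le_iSup (fun i ↦ IntermediateField.adjoin E (Set.range (emb i))) i
          (IntermediateField.subset_adjoin _ _ ⟨_, rfl⟩)
  · intro g p
    rw [hz]
    exact Submodule.subset_span ⟨_, rfl⟩

end WreathInvariants


/-! ### Faithful two-dimensional representations -/

section Planes

variable {k : Type*} [Field k]

lemma exists_injective_monoidHom_units [IsAlgClosed k] (C : Type*) [Group C] [Finite C] [IsCyclic C]
    (hC : (Nat.card C : k) ≠ 0) : ∃ χ : C →* kˣ, Function.Injective χ := by
  have : NeZero (Nat.card C) := ⟨Nat.card_pos.ne'⟩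
  have : NeZero (Nat.card C : k) := ⟨hC⟩
  have := IsSepClosed.hasEnoughRootsOfUnity k (Nat.card C)
  have : IsCyclic (rootsOfUnity (Nat.card C) k) := HasEnoughRootsOfUnity.cyc
  let e : C ≃* rootsOfUnity (Nat.card C) k :=
    mulEquivOfCyclicCardEq (HasEnoughRootsOfUnity.natCard_rootsOfUnity k (Nat.card C)).symm
  exact ⟨(Subgroup.subtype _).comp e.toMonoidHom,
    Subtype.val_injective.comp e.injective⟩

/-- A faithful character acting by scalars. Dimension two is chosen so that cyclic groups and groups
with a cyclic subgroup of index two fall under the same theorem on planes. -/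
lemma exists_injective_representation_of_isCyclic [IsAlgClosed k] (D : Type*) [Group D] [Finite D]
    [IsCyclic D] (hD : (Nat.card D : k) ≠ 0) :
    ∃ δ : Representation k D (Fin 2 → k), Function.Injective δ := by
  obtain ⟨χ, hχ⟩ := exists_injective_monoidHom_units D hD
  refine ⟨(Algebra.lsmul k k (Fin 2 → k)).toMonoidHom.comp ((Units.coeHom k).comp χ),
    fun d e h ↦ hχ (Units.ext ?_)⟩
  simpa using congr($h 1 0)

/-- A group with a cyclic subgroup of index two has a faithful two-dimensional representation,
induced from the subgroup. -/
lemma exists_injective_representation_of_index_eq_two [IsAlgClosed k] {D : Type*} [Group D]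
    {C : Subgroup D} [Finite C] [IsCyclic C] (hi : C.index = 2) (hC : (Nat.card C : k) ≠ 0) :
    ∃ δ : Representation k D (Fin 2 → k), Function.Injective δ := by
  classical
  obtain ⟨χ, hχ⟩ := exists_injective_monoidHom_units C hC
  obtain ⟨s, hs⟩ : ∃ s, s ∉ C := by
    by_contra! h
    rw [(Subgroup.eq_top_iff' C).mpr h] at hi
    simp at hi
  -- The character extended by zero. The matrix with entries `c (t i * d * (t j)⁻¹)`, for the coset
  -- representatives 1 and `s`, is that of the induced representation.
  let c : D → k := fun d ↦ if h : d ∈ C then χ ⟨d, h⟩ else 0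
  have hc0 : ∀ {d}, d ∉ C → c d = 0 := fun h ↦ dif_neg h
  have hc1 : c 1 = 1 := by
    simp only [c, dif_pos C.one_mem]
    exact congr(($(map_one χ)).val)
  have hcmul : ∀ {x y}, x ∈ C → y ∈ C → c (x * y) = c x * c y := by
    intro x y hx hy
    simp only [c, dif_pos hx, dif_pos hy, dif_pos (C.mul_mem hx hy)]
    rw [← Units.val_mul, ← map_mul]
    rfl
  have hm : ∀ {x y}, x * y ∈ C ↔ (x ∈ C ↔ y ∈ C) := Subgroup.mul_mem_iff_of_index_two hi
  have hs' : s⁻¹ ∉ C := by simpa using hs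
  -- This is multiplicativity of these matrices: exactly one of `x` and `x * s⁻¹` lies in `C`, so at
  -- most one term on the right survives.
  have key : ∀ x y, c (x * y) = c x * c y + c (x * s⁻¹) * c (s * y) := by
    intro x y
    by_cases hx : x ∈ C <;> by_cases hy : y ∈ C
    · rw [hcmul hx hy, hc0 (d := x * s⁻¹) (by simp [hm, hx, hs]), zero_mul, add_zero]
    · rw [hc0 (d := x * y) (by simp [hm, hx, hy]), hc0 hy,
        hc0 (d := x * s⁻¹) (by simp [hm, hx, hs]), zero_mul, mul_zero, add_zero]
    · rw [hc0 (d := x * y) (by simp [hm, hx, hy]), hc0 hx,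
        hc0 (d := s * y) (by simp [hm, hy, hs]), zero_mul, mul_zero, add_zero]
    · rw [hc0 hx, zero_mul, zero_add, ← hcmul (by simp [hm, hx, hs]) (by simp [hm, hy, hs])]
      congr 1
      group
  let t : Fin 2 → D := ![1, s]
  let M : D →* Matrix (Fin 2) (Fin 2) k :=
    { toFun d := Matrix.of fun i j ↦ c (t i * d * (t j)⁻¹)
      map_one' := by
        ext i j
        fin_cases i <;> fin_cases j <;> simp [t, hc1, hc0 hs, hc0 hs']
      map_mul' d e := by
        ext i j
        rw [Matrix.mul_apply, Fin.sum_univ_two]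
        simp only [Matrix.of_apply]
        have := key (t i * d) (e * (t j)⁻¹)
        simp only [t, Matrix.cons_val_zero, Matrix.cons_val_one, inv_one, mul_one, one_mul] at this ⊢
        simpa only [mul_assoc] using this }
  refine ⟨(Matrix.toLinAlgEquiv' (R := k) (n := Fin 2)).toMulEquiv.toMonoidHom.comp M, ?_⟩
  rw [injective_iff_map_eq_one]
  intro d hd
  have h1 : M d = 1 := Matrix.toLinAlgEquiv'.injective (hd.trans (map_one _).symm)
  have h2 : c d = 1 := by simpa [M, t] using congr($h1 0 0)
  have h3 : d ∈ C := by
    by_contra h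
    rw [hc0 h] at h2
    exact zero_ne_one h2
  have h4 : χ ⟨d, h3⟩ = 1 := Units.ext (by simpa [c, h3] using h2)
  simpa using (injective_iff_map_eq_one χ).mp hχ _ h4

end Planes

/-! ### Sylow subgroups of symmetric groups -/

section SylowSymmetric

/-- The image has the order of a Sylow subgroup, hence is one, and Sylow subgroups are conjugate. An
embedding and an order count thus identify a Sylow subgroup up to isomorphism. -/
lemma Sylow.nonempty_mulEquiv_of_injective {Γ H : Type*} [Group Γ] [Group H] [Finite H] {p : ℕ}
    [Fact p.Prime] {f : Γ →* H} (hf : Function.Injective f)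
    (h : Nat.card Γ = p ^ (Nat.card H).factorization p) (P : Sylow p H) : Nonempty (Γ ≃* P) := by
  let e := MonoidHom.ofInjective hf
  exact ⟨e.trans ((Sylow.ofCard f.range ((Nat.card_congr e.toEquiv).symm.trans h)).equiv P)⟩

lemma HasRationalInvariants.of_subsingleton (k : Type u) [Field k] (G : Type*) [Group G]
    [Subsingleton G] : HasRationalInvariants k G := by
  have hinj : Function.Injective (1 : Representation k G PUnit.{u + 1}) :=
    Function.injective_of_subsingleton _
  refine ⟨PUnit, inferInstance, inferInstance, 1, inferInstance, hinj, 0, Fin.elim0,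
    algebraicIndependent_empty_type, ?_⟩
  rw [show (1 : Representation k G PUnit.{u + 1}).fieldAct.fixedField = ⊤ from
    top_le_iff.mp fun x _ ↦ MonoidHom.mem_fixedField.mpr fun g ↦ by
      rw [Subsingleton.elim g 1, map_one]; rfl]
  have := SymmetricField.adjoin_range_basis (Module.Basis.empty PUnit.{u + 1} (R := k) (ι := Fin 0))
  rw [← this, Set.range_eq_empty, Set.range_eq_empty]

/-- The faithful action of a wreath product of `D` on `X × D`. -/
def WreathProduct.toPerm (D P X : Type*) [Group D] [Group P] [MulAction P X] :
    WreathProduct D P X →* Equiv.Perm (X × D) where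
  toFun g :=
    { toFun p := (g.right • p.1, g.left (g.right • p.1) * p.2)
      invFun p := (g.right⁻¹ • p.1, (g.left p.1)⁻¹ * p.2)
      left_inv p := by simp
      right_inv p := by simp }
  map_one' := by ext p <;> simp
  map_mul' g h := by ext p <;> simp [permuteCoordinates, mul_smul, mul_assoc]

lemma WreathProduct.toPerm_injective (D P X : Type*) [Group D] [Group P] [MulAction P X]
    [FaithfulSMul P X] : Function.Injective (WreathProduct.toPerm D P X) := by
  rw [injective_iff_map_eq_one]
  intro g hg
  have h : ∀ x, g.right • x = x ∧ g.left (g.right • x) = 1 := by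
    intro x
    simpa [WreathProduct.toPerm] using congr($hg (x, 1))
  have hr : g.right = 1 := eq_of_smul_eq_smul (α := X) fun x ↦ by simpa using (h x).1
  refine SemidirectProduct.ext (funext fun x ↦ ?_) hr
  have := (h x).2
  rwa [(h x).1] at this

/-- With m' = ⌊m/ℓ⌋, Legendre's formula v(m!) = m' + v(m'!) says that the wreath product of ℤ/ℓ with
a Sylow subgroup on m' letters has the right order, and it permutes m'ℓ ≤ m letters. If m < ℓ, both
groups are trivial. -/
lemma Sylow.hasRationalInvariants_perm (k : Type u) [Field k] [IsAlgClosed k] (ℓ : ℕ)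
    [hℓ : Fact ℓ.Prime] (hk : (ℓ : k) ≠ 0) (m : ℕ) :
    ∀ P : Sylow ℓ (Equiv.Perm (Fin m)), HasRationalInvariants k P := by
  induction m using Nat.strong_induction_on with
  | _ m ih =>
  intro P
  rcases Nat.eq_zero_or_pos m with rfl | hm
  · exact .of_subsingleton k P
  · let m' := m / ℓ
    have hlt : m' < m := Nat.div_lt_self hm hℓ.out.one_lt
    let P' : Sylow ℓ (Equiv.Perm (Fin m')) := default
    let D := Multiplicative (ZMod ℓ)
    have hD : Nat.card D = ℓ := by simp [D]
    obtain ⟨δ, hδ⟩ := exists_injective_representation_of_isCyclic (k := k) D (by rwa [hD])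
    have hΓ : HasRationalInvariants k (WreathProduct D P' (Fin m')) :=
      HasRationalInvariants.wreath hδ (by simp) (ih m' hlt P')
    have hle : Nat.card (Fin m' × D) ≤ Nat.card (Fin m) := by
      rw [Nat.card_prod, hD, Nat.card_fin, Nat.card_fin]
      exact Nat.div_mul_le_self m ℓ
    have : Finite D := Nat.finite_of_card_ne_zero (by rw [hD]; exact hℓ.out.ne_zero)
    have := Fintype.ofFinite (Fin m' × D)
    obtain ⟨ι⟩ : Nonempty ((Fin m' × D) ↪ Fin m) := by
      refine Function.Embedding.nonempty_of_card_le ?_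
      rwa [Nat.card_eq_fintype_card, Nat.card_eq_fintype_card] at hle
    obtain ⟨e⟩ := Sylow.nonempty_mulEquiv_of_injective
      (f := (Equiv.Perm.viaEmbeddingHom ι).comp (WreathProduct.toPerm D P' (Fin m')))
      ((Equiv.Perm.viaEmbeddingHom_injective ι).comp (WreathProduct.toPerm_injective D P' (Fin m')))
      (by
        rw [WreathProduct.natCard, hD, P'.card_eq_multiplicity, Nat.card_perm, Nat.card_perm,
          Nat.card_fin, Nat.card_fin, Nat.factorization_def _ hℓ.out,
          Nat.factorization_def _ hℓ.out, ← padicValNat_mul_div_factorial m,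
          padicValNat_factorial_mul, add_comm, pow_add]) P
    exact hΓ.of_mulEquiv e

end SylowSymmetric


/-! ### The power of ℓ dividing the order of GL_n -/

section Valuation

variable {ℓ : ℕ}

lemma Matrix.factorization_natCard_GL {F : Type*} [Field F] [Finite F]
    (hℓ : ¬ ℓ ∣ Nat.card F) [Fact ℓ.Prime] (n : ℕ) :
    (Nat.card (GL (Fin n) F)).factorization ℓ =
      ∑ j ∈ Finset.range n, (Nat.card F ^ (j + 1) - 1).factorization ℓ := by
  have := Fintype.ofFinite F
  rw [Matrix.card_GL_field, ← Nat.card_eq_fintype_card]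
  set q := Nat.card F
  have hq : 1 < q := Finite.one_lt_card
  rw [← Finset.prod_range (fun i ↦ q ^ n - q ^ i), Nat.factorization_prod_apply,
    ← Finset.sum_range_reflect]
  · refine Finset.sum_congr rfl fun i hi ↦ ?_
    rw [Finset.mem_range] at hi
    have h1 : q ^ n - q ^ (n - 1 - i) = q ^ (n - 1 - i) * (q ^ (i + 1) - 1) := by
      rw [Nat.mul_sub, mul_one, ← pow_add]
      congr 2
      omega
    have h2 : q ^ (i + 1) - 1 ≠ 0 := (Nat.sub_pos_of_lt (Nat.one_lt_pow (by omega) hq)).ne'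
    rw [h1, Nat.factorization_mul (by positivity) h2, Nat.factorization_pow]
    simp [Nat.factorization_eq_zero_of_not_dvd hℓ]
  · intro i hi
    exact (Nat.sub_pos_of_lt (Nat.pow_lt_pow_right hq (Finset.mem_range.mp hi))).ne'

/-- Among the exponents 1, …, n the ⌊n/e⌋ multiples of `e` contribute `a` plus the valuation of
their index, which add up to the valuation of a factorial; each of the others contributes `b`. -/
lemma sum_range_factorization_pow_sub_one [Fact ℓ.Prime] {q e a b : ℕ} (he : 0 < e)
    (h1 : ∀ j, j ≠ 0 → (q ^ (e * j) - 1).factorization ℓ = a + j.factorization ℓ)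
    (h2 : ∀ j, ¬ e ∣ j → (q ^ j - 1).factorization ℓ = b) (n : ℕ) :
    ∑ j ∈ Finset.range n, (q ^ (j + 1) - 1).factorization ℓ =
      a * (n / e) + (n / e).factorial.factorization ℓ + b * (n - n / e) := by
  induction n with
  | zero => simp
  | succ n ih =>
    rw [Finset.sum_range_succ, ih, Nat.succ_div]
    have hle := Nat.div_le_self n e
    split_ifs with h
    · obtain ⟨j, hj⟩ := h
      have hj' : n / e + 1 = j := by
        have := Nat.succ_div (a := n) (b := e)
        rw [if_pos ⟨j, hj⟩, hj, Nat.mul_div_cancel_left _ he] at this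
        exact this.symm
      have hj0 : j ≠ 0 := hj' ▸ Nat.succ_ne_zero _
      rw [hj, h1 j hj0, Nat.factorial_succ, Nat.factorization_mul (Nat.succ_ne_zero _)
        (Nat.factorial_ne_zero _), hj', ← hj, ← hj', Nat.add_sub_add_right, Finsupp.add_apply]
      ring
    · rw [h2 _ h, add_zero, Nat.sub_add_comm hle]
      ring

/-- Lifting the exponent. For ℓ = 2 divisibility by 4 is essential: if q ≡ 3 mod 4, the factor q + 1
of q² − 1 brings in more than one factor 2. -/
lemma Nat.factorization_pow_sub_one [hp : Fact ℓ.Prime] {q : ℕ} (hq : 1 < q)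
    (h : (Odd ℓ ∧ ℓ ∣ q - 1) ∨ (ℓ = 2 ∧ 4 ∣ q - 1)) {j : ℕ} (hj : j ≠ 0) :
    (q ^ j - 1).factorization ℓ = (q - 1).factorization ℓ + j.factorization ℓ := by
  have hdvd : ℓ ∣ q - 1 := by
    obtain h | ⟨rfl, h⟩ := h
    · exact h.2
    · exact dvd_trans (by norm_num) h
  have hndvd : ¬ ℓ ∣ q := by
    intro h'
    have := (Nat.dvd_sub h' hdvd)
    rw [Nat.sub_sub_self hq.le] at this
    exact hp.out.one_lt.ne' (Nat.dvd_one.mp this)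
  rw [Nat.factorization_def _ hp.out, Nat.factorization_def _ hp.out,
    Nat.factorization_def _ hp.out]
  obtain h | ⟨rfl, h⟩ := h
  · simpa using padicValNat.pow_sub_pow h.1 hq (by simpa using h.2) hndvd hj
  · have h0 : q ^ j - 1 ≠ 0 := (Nat.sub_pos_of_lt (Nat.one_lt_pow hj hq)).ne'
    have key := Int.two_pow_sub_pow' (x := q) (y := 1) j (by omega) (by omega)
    rw [one_pow, show (q : ℤ) ^ j - 1 = ((q ^ j - 1 : ℕ) : ℤ) by
        rw [Nat.cast_sub (Nat.one_le_pow _ _ (by omega))]; simp,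
      show (q : ℤ) - 1 = ((q - 1 : ℕ) : ℤ) by rw [Nat.cast_sub hq.le]; simp] at key
    rw [← Nat.cast_ofNat, Int.natCast_emultiplicity, Int.natCast_emultiplicity,
      Int.natCast_emultiplicity, ← padicValNat_eq_emultiplicity h0,
      ← padicValNat_eq_emultiplicity (by omega), ← padicValNat_eq_emultiplicity hj] at key
    exact_mod_cast key

end Valuation

/-! ### Sylow subgroups of general linear groups, ℓ nonzero in k -/

section GeneralLinear

variable {F : Type*} [Field F]

/-- A trivial summand fills up the dimension to `n`. -/
lemma Representation.exists_monoidHom_GL {Γ W : Type*} [Group Γ] [AddCommGroup W] [Module F W]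
    [FiniteDimensional F W] {ρ : Representation F Γ W} (hρ : Function.Injective ρ) {n : ℕ}
    (hn : Module.finrank F W ≤ n) : ∃ f : Γ →* GL (Fin n) F, Function.Injective f := by
  let σ := ρ.prod (1 : Representation F Γ (Fin (n - Module.finrank F W) → F))
  let b := Module.finBasisOfFinrankEq F (W × (Fin (n - Module.finrank F W) → F)) (n := n)
    (by rw [Module.finrank_prod, Module.finrank_fin_fun]; omega)
  refine ⟨(Units.map (LinearMap.toMatrixAlgEquiv b).toMulEquiv.toMonoidHom).comp
    (MonoidHom.toHomUnits σ), fun x y h ↦ hρ (LinearMap.ext fun w ↦ ?_)⟩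
  have : σ x = σ y := (LinearMap.toMatrixAlgEquiv b).injective (congrArg Units.val h)
  exact congr(($this (w, 0)).1)

lemma Representation.wreath_injective {D P X W : Type*} [Group D] [Group P] [MulAction P X]
    [FaithfulSMul P X] [AddCommGroup W] [Module F W] [Nontrivial W] {δ : Representation F D W}
    (hδ : Function.Injective δ) : Function.Injective (δ.wreath P X) := by
  classical
  rw [injective_iff_map_eq_one]
  intro g hg
  refine Representation.left_eq_one_of_wreath_eq_one hδ ?_ hg
  obtain ⟨w, hw⟩ := exists_ne (0 : W)
  refine eq_of_smul_eq_smul (α := X) fun x ↦ ?_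
  rw [one_smul]
  by_contra h
  have h1 := δ.wreath_single g x w
  rw [hg] at h1
  have h2 := congr($h1 x)
  simp [Ne.symm h] at h2
  exact hw h2

lemma exists_injective_representation_units (F : Type*) [Field F] {E : Type*} [Field E]
    [Algebra F E] (C : Subgroup Eˣ) : ∃ δ : Representation F C E, Function.Injective δ := by
  refine ⟨(Algebra.lmul F E).toMonoidHom.comp ((Units.coeHom E).comp C.subtype), fun x y h ↦ ?_⟩
  refine Subtype.ext (Units.ext ?_)
  simpa using congr($h 1)

lemma Matrix.exists_injective_representation_GL {n : Type*} [Fintype n] [DecidableEq n]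
    (D : Subgroup (GL n F)) : ∃ δ : Representation F D (n → F), Function.Injective δ := by
  refine ⟨(Matrix.toLinAlgEquiv' (R := F) (n := n)).toMulEquiv.toMonoidHom.comp
    ((Units.coeHom _).comp D.subtype), fun x y h ↦ ?_⟩
  exact Subtype.ext (Units.ext (Matrix.toLinAlgEquiv'.injective h))

lemma FiniteField.exists_extension (F : Type*) [Field F] [Finite F] {e : ℕ} (he : e ≠ 0) :
    ∃ (E : Type) (_ : Field E) (_ : Algebra F E), Finite E ∧ Module.finrank F E = e ∧
      Nat.card E = Nat.card F ^ e := by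
  obtain ⟨p, hp⟩ := CharP.exists F
  have : Fact p.Prime := ⟨CharP.char_is_prime F p⟩
  have : NeZero e := ⟨he⟩
  exact ⟨FiniteField.Extension F p e, inferInstance, inferInstance,
    Nat.finite_of_card_ne_zero 
      (by rw [FiniteField.natCard_extension]; exact pow_ne_zero _ Nat.card_pos.ne'),
    FiniteField.finrank_extension F p e, FiniteField.natCard_extension F p e⟩

lemma IsPGroup.natCard_ne_zero {k : Type*} [Field k] {ℓ : ℕ} (hk : (ℓ : k) ≠ 0) {D : Type*}
    [Group D] [Finite D] [Fact ℓ.Prime] (h : IsPGroup ℓ D) : (Nat.card D : k) ≠ 0 := by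
  obtain ⟨r, hr⟩ := IsPGroup.iff_card.mp h
  rw [hr, Nat.cast_pow]
  exact pow_ne_zero r hk

variable (k : Type u) [Field k] [IsAlgClosed k] {ℓ : ℕ} [hℓ : Fact ℓ.Prime]

/-- The case in which the Sylow subgroup is a wreath product of a cyclic group. -/
lemma Sylow.hasRationalInvariants_GL_of_dvd [Finite F] (hk : (ℓ : k) ≠ 0)
    (hF : ¬ ℓ ∣ Nat.card F) {e : ℕ} (he : 0 < e)
    (h1 : (Odd ℓ ∧ ℓ ∣ Nat.card F ^ e - 1) ∨ (ℓ = 2 ∧ 4 ∣ Nat.card F ^ e - 1))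
    (h2 : ∀ j, ¬ e ∣ j → (Nat.card F ^ j - 1).factorization ℓ = 0) {n : ℕ}
    (G : Sylow ℓ (GL (Fin n) F)) : HasRationalInvariants k G := by
  obtain ⟨E, _, _, _, hE, hcard⟩ := FiniteField.exists_extension F he.ne'
  have : FiniteDimensional F E := Module.finite_of_finrank_pos (by omega)
  have hq : 1 < Nat.card F := Finite.one_lt_card
  let m := n / e
  let D : Sylow ℓ Eˣ := default
  let P : Sylow ℓ (Equiv.Perm (Fin m)) := default
  obtain ⟨δ, hδ⟩ := exists_injective_representation_of_isCyclic (k := k) D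
    (IsPGroup.natCard_ne_zero hk D.isPGroup')
  have hΓ : HasRationalInvariants k (WreathProduct D P (Fin m)) :=
    .wreath hδ (by simp) (Sylow.hasRationalInvariants_perm k ℓ hk m P)
  -- A second representation, over `F`, serves only to embed the wreath product: D acts on `E` by
  -- multiplication, so the wreath product acts on E^m, of `F`-dimension em ≤ n.
  obtain ⟨ε, hε⟩ := exists_injective_representation_units F (D : Subgroup Eˣ)
  obtain ⟨f, hf⟩ := (ε.wreath P (Fin m)).exists_monoidHom_GL (Representation.wreath_injective hε)
    (n := n) (by
      rw [Module.finrank_pi_fintype, Finset.sum_const, Finset.card_fin, hE, smul_eq_mul]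
      exact Nat.div_mul_le_self n e)
  obtain ⟨i⟩ := Sylow.nonempty_mulEquiv_of_injective hf (by
    rw [WreathProduct.natCard, Matrix.factorization_natCard_GL hF,
      sum_range_factorization_pow_sub_one he (fun j hj ↦ by
        rw [pow_mul, Nat.factorization_pow_sub_one (Nat.one_lt_pow he.ne' hq) h1 hj]) h2,
      D.card_eq_multiplicity, P.card_eq_multiplicity, Nat.card_units, hcard, Nat.card_perm,
      Nat.card_fin, zero_mul, add_zero, ← pow_mul, pow_add]) G
  exact hΓ.of_mulEquiv i

/-- The case of a `2`-Sylow subgroup and `q` congruent to `3` modulo `4`, in which the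
Sylow subgroup is a product of a group of order at most two and a wreath product of a
semidihedral group. -/
lemma Sylow.hasRationalInvariants_GL_of_mod_four [Finite F] (hk : (2 : k) ≠ 0)
    (hF : Nat.card F % 4 = 3) {n : ℕ} (G : Sylow 2 (GL (Fin n) F)) :
    HasRationalInvariants k G := by
  have hF' : ¬ 2 ∣ Nat.card F := by omega
  have hq : 1 < Nat.card F := Finite.one_lt_card
  obtain ⟨E, _, _, _, hE, hcard⟩ := FiniteField.exists_extension F two_ne_zero
  have : FiniteDimensional F E := Module.finite_of_finrank_pos (by omega)
  have h4 : 4 ∣ Nat.card F ^ 2 - 1 := by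
    have : Nat.card F ^ 2 % 4 = 1 := by rw [Nat.pow_mod, hF]
    omega
  -- For odd `j` also q^j ≡ 3 mod 4, so every odd exponent contributes exactly one factor 2 to the
  -- order of GL_n.
  have hodd : ∀ j, ¬ 2 ∣ j → (Nat.card F ^ j - 1).factorization 2 = 1 := by
    intro j hj
    have h : Nat.card F ^ j % 4 = 3 := by
      obtain ⟨i, rfl⟩ : Odd j := Nat.not_even_iff_odd.mp fun h ↦ hj h.two_dvd
      rw [pow_succ, pow_mul, Nat.mul_mod, Nat.pow_mod, Nat.pow_mod (Nat.card F), hF]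
      simp
    have h0 : Nat.card F ^ j - 1 ≠ 0 := by omega
    refine le_antisymm ?_ ?_
    · by_contra! h'
      have : 2 ^ 2 ∣ Nat.card F ^ j - 1 :=
        (Nat.prime_two.pow_dvd_iff_le_factorization h0).mpr h'
      omega
    · rw [← Nat.prime_two.pow_dvd_iff_le_factorization h0]
      omega
  have hcount := fun n ↦ (Matrix.factorization_natCard_GL hF' n).trans
    (sum_range_factorization_pow_sub_one two_pos (fun j hj ↦ by
        rw [pow_mul, Nat.factorization_pow_sub_one (Nat.one_lt_pow two_ne_zero hq)
          (.inr ⟨rfl, h4⟩) hj]) hodd n)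
  let m := n / 2
  let C : Sylow 2 Eˣ := default
  let P : Sylow 2 (Equiv.Perm (Fin m)) := default
  obtain ⟨γ, hγ⟩ := exists_injective_representation_units F (C : Subgroup Eˣ)
  obtain ⟨c, hc⟩ := γ.exists_monoidHom_GL hγ hE.le
  let C' := c.range
  let eC : C ≃* C' := MonoidHom.ofInjective hc
  -- `C'` is the 2-part of the units of 𝔽_{q²} acting on 𝔽_{q²} ≅ 𝔽_q². The order of GL₂ has
  -- valuation v(q² − 1) + 1, so `C'` has index two in any 2-Sylow subgroup containing it.
  obtain ⟨D, hD⟩ := IsPGroup.exists_le_sylow (C.isPGroup'.of_equiv eC)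
  let C₁ : Subgroup D := C'.subgroupOf D
  let e₁ : C₁ ≃* C' := Subgroup.subgroupOfEquivOfLe hD
  have : IsCyclic C₁ := isCyclic_of_surjective _ (eC.trans e₁.symm).surjective
  have hC₁ : Nat.card C₁ = Nat.card C := Nat.card_congr (eC.trans e₁.symm).symm.toEquiv
  have hindex : C₁.index = 2 := by
    have := C₁.card_mul_index
    rw [hC₁, C.card_eq_multiplicity, D.card_eq_multiplicity, hcount, Nat.card_units, hcard] at this
    simpa [pow_succ] using this
  obtain ⟨δ, hδ⟩ := exists_injective_representation_of_index_eq_two (k := k) hindex (by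
    rw [hC₁]
    exact IsPGroup.natCard_ne_zero (by simpa using hk) C.isPGroup')
  have hΓ : HasRationalInvariants k (WreathProduct D P (Fin m)) :=
    .wreath hδ (by simp) (Sylow.hasRationalInvariants_perm k 2 (by simpa using hk) m P)
  obtain ⟨ε, hε⟩ := Matrix.exists_injective_representation_GL (D : Subgroup (GL (Fin 2) F))
  have hcardΓ : Nat.card (WreathProduct D P (Fin m)) =
      2 ^ ((Nat.card F ^ 2 - 1).factorization 2 * m + m.factorial.factorization 2 + m) := by
    rw [WreathProduct.natCard, D.card_eq_multiplicity, hcount, P.card_eq_multiplicity,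
      Nat.card_perm, Nat.card_fin, ← pow_mul, ← pow_add]
    congr 1
    simp
    ring
  rcases Nat.even_or_odd n with ⟨r, hr⟩ | ⟨r, hr⟩
  · obtain ⟨f, hf⟩ := (ε.wreath P (Fin m)).exists_monoidHom_GL (Representation.wreath_injective hε)
      (n := n) (by rw [Module.finrank_pi_fintype]; simp [m]; omega)
    obtain ⟨i⟩ := Sylow.nonempty_mulEquiv_of_injective hf (by
      rw [hcardΓ, hcount]
      congr 2
      omega) G
    exact hΓ.of_mulEquiv i
  -- For odd `n` one coordinate is left over, and there are m + 1 odd exponents up to `n`; the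
  -- missing factor 2 is {±1} acting on that coordinate.
  · let S : Subgroup Fˣ := Subgroup.zpowers (-1)
    have hS : Nat.card S = 2 := by
      rw [Nat.card_zpowers, ← orderOf_units, Units.val_neg, Units.val_one, orderOf_neg_one,
        if_neg]
      intro h
      have : CharP F 2 := h ▸ ringChar.charP F
      have := Fintype.ofFinite F
      obtain ⟨s, -, hs⟩ := FiniteField.card F 2
      rw [← Nat.card_eq_fintype_card] at hs
      exact hF' (hs ▸ dvd_pow_self 2 s.ne_zero)
    obtain ⟨η, hη⟩ := exists_injective_representation_of_isCyclic (k := k) S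
      (by rw [hS]; exact_mod_cast hk)
    obtain ⟨ζ, hζ⟩ := exists_injective_representation_units F S
    -- The direct product with `S` is written as a wreath product over a one-point set, so the
    -- theorem on wreath products covers it.
    have hΔ : HasRationalInvariants k (WreathProduct S (WreathProduct D P (Fin m)) Unit) :=
      .wreath hη (by simp) hΓ
    let τ : Representation F (WreathProduct S (WreathProduct D P (Fin m)) Unit)
        ((Fin m → Fin 2 → F) × (Unit → F)) :=
      Representation.prod ((ε.wreath P (Fin m)).comp SemidirectProduct.rightHom)
        (ζ.wreath (WreathProduct D P (Fin m)) Unit)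
    have hτ : Function.Injective τ := by
      rw [injective_iff_map_eq_one]
      intro g hg
      refine Representation.left_eq_one_of_wreath_eq_one hζ
        ((injective_iff_map_eq_one (ε.wreath P (Fin m))).mp
          (Representation.wreath_injective hε) _ (LinearMap.ext fun w ↦ ?_))
        (LinearMap.ext fun w ↦ ?_)
      · exact congr(($hg (w, 0)).1)
      · exact congr(($hg (0, w)).2)
    obtain ⟨f, hf⟩ := τ.exists_monoidHom_GL hτ (n := n) (by
      rw [Module.finrank_prod, Module.finrank_pi_fintype]; simp [m]; omega)
    obtain ⟨i⟩ := Sylow.nonempty_mulEquiv_of_injective hf (by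
      rw [WreathProduct.natCard, hcardΓ, hS, hcount, Nat.card_unique, pow_one, ← pow_succ']
      congr 1
      simp only [m]
      omega) G
    exact hΔ.of_mulEquiv i

/-- For odd ℓ, `e` is the multiplicative order of q modulo ℓ, so that ℓ divides q^j − 1 exactly when
`e` divides `j`. For ℓ = 2 and q ≡ 1 mod 4, `e = 1` works; q ≡ 3 mod 4 is the exceptional case. -/
theorem Sylow.hasRationalInvariants_GL [Finite F] (hk : (ℓ : k) ≠ 0) (hF : ¬ ℓ ∣ Nat.card F)
    {n : ℕ} (G : Sylow ℓ (GL (Fin n) F)) : HasRationalInvariants k G := by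
  have hq : 1 < Nat.card F := Finite.one_lt_card
  rcases hℓ.out.eq_two_or_odd' with rfl | hodd
  · rcases (by omega : Nat.card F % 4 = 1 ∨ Nat.card F % 4 = 3) with h | h
    · exact Sylow.hasRationalInvariants_GL_of_dvd k hk hF one_pos
        (.inr ⟨rfl, by rw [pow_one]; omega⟩) (fun j hj ↦ (hj (one_dvd j)).elim) G
    · exact Sylow.hasRationalInvariants_GL_of_mod_four k (by exact_mod_cast hk) h G
  · have hdvd : ∀ j, ℓ ∣ Nat.card F ^ j - 1 ↔ orderOf (Nat.card F : ZMod ℓ) ∣ j := by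
      intro j
      rw [orderOf_dvd_iff_pow_eq_one, ← CharP.cast_eq_zero_iff (ZMod ℓ) ℓ,
        Nat.cast_sub (Nat.one_le_pow _ _ (by omega)), sub_eq_zero]
      simp
    have hu : IsUnit (Nat.card F : ZMod ℓ) := by
      rw [isUnit_iff_ne_zero, Ne, CharP.cast_eq_zero_iff (ZMod ℓ) ℓ]
      exact hF
    refine Sylow.hasRationalInvariants_GL_of_dvd k hk hF
      (e := orderOf (Nat.card F : ZMod ℓ)) ?_ (.inl ⟨hodd, (hdvd _).mpr dvd_rfl⟩)
      (fun j hj ↦ Nat.factorization_eq_zero_of_not_dvd (mt (hdvd j).mp hj)) G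
    obtain ⟨w, hw⟩ := hu
    rw [← hw, orderOf_units]
    exact orderOf_pos w

end GeneralLinear


/-! ### Groups of order a power of the characteristic of k -/

section Unipotent

/-- The span of an orbit over the prime field is finite, of order divisible by p; a p-group fixing 0
in it fixes another point. Working over the prime field allows `M` to be a space over an infinite
field. -/
lemma IsPGroup.exists_ne_zero_forall_addMonoidHom_eq {G M : Type*} [Group G] [Finite G]
    [AddCommGroup M] [Nontrivial M] {p : ℕ} [hp : Fact p.Prime] [Module (ZMod p) M]
    (hG : IsPGroup p G) (σ : G →* AddMonoid.End M) : ∃ m ≠ 0, ∀ g, σ g m = m := by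
  obtain ⟨m, hm⟩ := exists_ne (0 : M)
  let S : Submodule (ZMod p) M := Submodule.span (ZMod p) (Set.range fun g ↦ σ g m)
  have hmS : m ∈ S := Submodule.subset_span ⟨1, by simp⟩
  have hS : ∀ g, ∀ x ∈ S, σ g x ∈ S := by
    intro g x hx
    have : S ≤ S.comap ((σ g).toZModLinearMap p) := by
      rw [Submodule.span_le]
      rintro _ ⟨h, rfl⟩
      exact Submodule.subset_span ⟨g * h, by simp; rfl⟩
    exact this hx
  let _ : MulAction G S :=
    { smul g x := ⟨σ g x, hS g x x.2⟩
      one_smul x := Subtype.ext (by change σ 1 x.1 = x.1; simp)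
      mul_smul g h x := Subtype.ext (by change σ (g * h) x.1 = σ g (σ h x.1); simp) }
  have : Module.Finite (ZMod p) S := Module.Finite.span_of_finite _ (Set.finite_range _)
  have : Finite S := Module.finite_of_finite (ZMod p)
  have : Nontrivial S := ⟨⟨m, hmS⟩, 0, fun h ↦ hm congr($h.1)⟩
  obtain ⟨b, hb, hb0⟩ := hG.exists_fixed_point_of_prime_dvd_card_of_fixed_point S (by
    rw [Module.natCard_eq_pow_finrank (K := ZMod p), Nat.card_zmod]
    exact dvd_pow_self p Module.finrank_pos.ne') (a := 0)
    (fun g ↦ Subtype.ext (map_zero (σ g)))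
  exact ⟨b, fun h ↦ hb0 (Subtype.ext h.symm), fun g ↦ congr($(hb g).1)⟩

lemma IsPGroup.exists_ne_zero_forall_apply_eq {k G M : Type*} [Field k] [Group G] [Finite G]
    [AddCommGroup M] [Module k M] [Nontrivial M] {p : ℕ} [hp : Fact p.Prime] (hG : IsPGroup p G)
    (hk : (p : k) = 0) (σ : Representation k G M) : ∃ m ≠ 0, ∀ g, σ g m = m := by
  have : Module (ZMod p) M := AddCommGroup.zmodModule fun x ↦ by
    rw [← Nat.cast_smul_eq_nsmul k, hk, zero_smul]
  exact hG.exists_ne_zero_forall_addMonoidHom_eq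
    { toFun g := (σ g).toAddMonoidHom
      map_one' := by ext; simp; rfl
      map_mul' g h := by ext; simp; rfl }

variable {k : Type*} [Field k] {G : Type*} [Group G] [Finite G]

/-- Invariants of a triangular action are generated by as many elements as there are
variables. -/
lemma Representation.exists_inf_fixedField_eq_adjoin {V : Type*} [AddCommGroup V] [Module k V]
    {p : ℕ} [Fact p.Prime] (hG : IsPGroup p G) (hk : (p : k) = 0) (ρ : Representation k G V)
    {r : ℕ} (hr : r ≤ Module.finrank k V) : ∃ v : Fin r → V, LinearIndependent k v ∧
      (∀ g i, ρ g (v i) ∈ Submodule.span k (Set.range v)) ∧ ∃ t : Fin r → SymmetricField k V,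
        IntermediateField.adjoin k (Set.range (SymmetricField.ι k V ∘ v)) ⊓ ρ.fieldAct.fixedField =
          IntermediateField.adjoin k (Set.range t) := by
  induction r with
  | zero =>
    refine ⟨Fin.elim0, linearIndependent_empty_type, fun _ i ↦ i.elim0, Fin.elim0, ?_⟩
    rw [Set.range_eq_empty, Set.range_eq_empty, IntermediateField.adjoin_empty]
    exact bot_inf_eq _
  | succ r ih =>
    obtain ⟨v, hv, hst, t, ht⟩ := ih (by omega)
    set U := Submodule.span k (Set.range v)
    have hUst : ∀ g, U ≤ U.comap (ρ g) := by
      intro g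
      rw [Submodule.span_le]
      rintro _ ⟨i, rfl⟩
      exact hst g i
    have hU : U ≠ ⊤ := by
      intro h
      have h1 := finrank_range_le_card (R := k) v
      rw [Set.finrank, show Submodule.span k (Set.range v) = ⊤ from h, finrank_top,
        Fintype.card_fin] at h1
      omega
    have : Nontrivial (V ⧸ U) := Submodule.Quotient.nontrivial_iff.mpr hU
    -- A fixed vector of V/U lifts to `w` with `g w - w` in `U`: the flag grows by one step, and `g`
    -- acts on the new variable by a translation, to which Miyata's theorem applies.
    obtain ⟨w', hw0, hw⟩ := hG.exists_ne_zero_forall_apply_eq hk (ρ.quotient U hUst)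
    obtain ⟨w, rfl⟩ := U.mkQ_surjective w'
    have hwU : w ∉ U := fun h ↦ hw0 ((Submodule.Quotient.mk_eq_zero U).mpr h)
    have hgw : ∀ g, ρ g w - w ∈ U := fun g ↦ (Submodule.Quotient.eq U).mp (hw g)
    have hv' : LinearIndependent k (Fin.snoc v w : Fin (r + 1) → V) := hv.finSnoc hwU
    have hrange : Set.range (SymmetricField.ι k V ∘ (Fin.snoc v w : Fin (r + 1) → V)) =
        Set.range (SymmetricField.ι k V ∘ v) ∪ {SymmetricField.ι k V w} := by
      rw [Set.range_comp, Fin.range_snoc, Set.image_insert_eq, ← Set.range_comp,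
        Set.union_singleton]
    set L := IntermediateField.adjoin k (Set.range (SymmetricField.ι k V ∘ v)) with hL
    have hUL : ∀ u ∈ U, SymmetricField.ι k V u ∈ L := by
      intro u hu
      rw [hL, Set.range_comp, SymmetricField.adjoin_image_ι_span]
      exact IntermediateField.subset_adjoin _ _ ⟨u, hu, rfl⟩
    have hLst : ∀ g, ∀ a ∈ L, ρ.fieldAct g a ∈ L := by
      intro g
      change L ≤ L.comap (ρ.fieldAct g).toAlgHom
      rw [hL, IntermediateField.adjoin_le_iff]
      rintro _ ⟨i, rfl⟩
      change ρ.fieldAct g (SymmetricField.ι k V (v i)) ∈ L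
      rw [Representation.fieldAct_ι]
      exact hUL _ (hst g i)
    have htr : Transcendental L (SymmetricField.ι k V w) := by
      have h := (SymmetricField.algebraicIndependent_of_linearIndependent
        hv').transcendental_intermediateField_adjoin (s := Set.range Fin.castSucc)
        (i := Fin.last r) (by rintro ⟨i, hi⟩; exact (Fin.castSucc_lt_last i).ne hi)
      have h1 : (SymmetricField.ι k V ∘ (Fin.snoc v w : Fin (r + 1) → V)) ∘ Fin.castSucc =
          SymmetricField.ι k V ∘ v := by
        ext i
        simp
      have h2 : (SymmetricField.ι k V ∘ (Fin.snoc v w : Fin (r + 1) → V)) (Fin.last r) =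
          SymmetricField.ι k V w := by
        simp
      rwa [← Set.range_comp, h1, h2] at h
    obtain ⟨f, hf⟩ := exists_fixedField_eq_adjoin_of_affine (φ := ρ.fieldAct) hLst htr fun g ↦
      ⟨1, one_mem _, _, hUL _ (hgw g), by rw [Representation.fieldAct_ι, one_mul, map_sub]; ring⟩
    refine ⟨Fin.snoc v w, hv', fun g i ↦ ?_, Fin.snoc t f, ?_⟩
    · rw [Fin.range_snoc]
      have hle : U ≤ Submodule.span k (insert w (Set.range v)) :=
        Submodule.span_mono (Set.subset_insert _ _)
      induction i using Fin.lastCases with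
      | last =>
        rw [Fin.snoc_last, ← sub_add_cancel (ρ g w) w]
        exact add_mem (hle (hgw g)) (Submodule.subset_span (Set.mem_insert _ _))
      | cast i =>
        rw [Fin.snoc_castSucc]
        exact hle (hst g i)
    · rw [hrange, ← IntermediateField.adjoin_adjoin_left, ← hL, hf, ht, Fin.range_snoc,
        ← Set.union_singleton]
      refine le_antisymm (IntermediateField.adjoin_le_iff.mpr (Set.union_subset ?_ ?_))
        (IntermediateField.adjoin.mono _ _ _
          (Set.union_subset_union_left _ (IntermediateField.subset_adjoin k _)))
      · exact IntermediateField.adjoin.mono _ _ _ Set.subset_union_left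
      · exact Set.subset_union_right.trans (IntermediateField.subset_adjoin _ _)

lemma IntermediateField.IsRational.of_natCard_le_trdeg {Ω : Type*} [Field Ω] [Algebra k Ω]
    {E : IntermediateField k Ω} {ι : Type*} [Finite ι] {t : ι → Ω}
    (hE : E = IntermediateField.adjoin k (Set.range t))
    (h : (Nat.card ι : Cardinal) ≤ Algebra.trdeg k E) : E.IsRational := by
  have ht : ∀ i, t i ∈ E := fun i ↦ hE ▸ IntermediateField.subset_adjoin _ _ ⟨i, rfl⟩
  let t' : ι → E := fun i ↦ ⟨t i, ht i⟩
  have hcomp : E.val ∘ t' = t := rfl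
  refine .of_finite (t := t) ?_ hE
  rw [← hcomp]
  refine (algebraicIndependent_of_natCard_le_trdeg ?_ h).map' (f := E.val) E.val.injective
  apply IntermediateField.map_injective E.val
  rw [IntermediateField.adjoin_map, ← Set.range_comp, hcomp, ← hE, ← AlgHom.fieldRange_eq_map]
  simp

end Unipotent

/-- A full flag yields dim V generators of the invariants, whose transcendence degree is dim V. -/
lemma IsPGroup.hasRationalInvariants {k V : Type u} {G : Type*} [Field k] [Group G] [Finite G]
    [AddCommGroup V] [Module k V] [FiniteDimensional k V] {p : ℕ} [Fact p.Prime]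
    (hG : IsPGroup p G) (hk : (p : k) = 0) {ρ : Representation k G V}
    (hρ : Function.Injective ρ) : HasRationalInvariants k G := by
  obtain ⟨v, hv, -, t, ht⟩ := ρ.exists_inf_fixedField_eq_adjoin hG hk le_rfl
  let b := basisOfLinearIndependentOfCardEqFinrank' v hv (by simp)
  have hb := SymmetricField.adjoin_range_basis b
  rw [coe_basisOfLinearIndependentOfCardEqFinrank'] at hb
  rw [hb, top_inf_eq] at ht
  refine ⟨V, _, _, ρ, inferInstance, hρ, .of_natCard_le_trdeg ht ?_⟩
  rw [MonoidHom.trdeg_fixedField, SymmetricField.trdeg_eq, Nat.card_fin]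


/-! ### Rings of polynomial invariants and their fraction fields -/

section SymInvariants

variable {k G L : Type*} [Field k] [Group G] [AddCommGroup L] [Module k L]

lemma SymmetricField.algebraMap_injective (k L : Type*) [Field k] [AddCommGroup L] [Module k L] :
    Function.Injective (algebraMap (SymmetricAlgebra k L) (SymmetricField k L)) :=
  IsFractionRing.injective _ _

/-- The action of `g` on the symmetric algebra. -/
noncomputable def Representation.symAct (ρ : Representation k G L) (g : G) :
    SymmetricAlgebra k L →ₐ[k] SymmetricAlgebra k L :=
  SymmetricAlgebra.lift (SymmetricAlgebra.ι k L ∘ₗ ρ g)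

/-- The ring of invariants of the symmetric algebra. -/
noncomputable def Representation.symInvariants (ρ : Representation k G L) :
    Subalgebra k (SymmetricAlgebra k L) where
  carrier := {f | ∀ g : G, ρ.symAct g f = f}
  mul_mem' ha hb g := by rw [map_mul, ha g, hb g]
  add_mem' ha hb g := by rw [map_add, ha g, hb g]
  algebraMap_mem' r g := (ρ.symAct g).commutes r

lemma Representation.symAct_ι (ρ : Representation k G L) (g : G) (f : L) :
    ρ.symAct g (SymmetricAlgebra.ι k _ f) = SymmetricAlgebra.ι k _ (ρ g f) := by
  simp [Representation.symAct]

lemma Representation.algebraMap_symAct (ρ : Representation k G L) (g : G)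
    (x : SymmetricAlgebra k L) :
    algebraMap _ (SymmetricField k L) (ρ.symAct g x) =
      ρ.fieldAct g (algebraMap _ _ x) := by
  have : (IsScalarTower.toAlgHom k (SymmetricAlgebra k L)
      (SymmetricField k L)).comp (ρ.symAct g) =
      (ρ.fieldAct g).toAlgHom.comp (IsScalarTower.toAlgHom k _ _) := by
    refine SymmetricAlgebra.algHom_ext (LinearMap.ext fun f ↦ ?_)
    change algebraMap _ (SymmetricField k L) (ρ.symAct g _) =
      ρ.fieldAct g (algebraMap _ _ _)
    rw [Representation.symAct_ι, SymmetricField.algebraMap_ι, SymmetricField.algebraMap_ι,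
      Representation.fieldAct_ι]
  exact congr($this x)

/-- The action of `G` on the symmetric algebra, as a semiring action. -/
noncomputable abbrev Representation.symMulSemiringAction (ρ : Representation k G L) :
    MulSemiringAction G (SymmetricAlgebra k L) where
  smul g x := ρ.symAct g x
  one_smul x := by
    apply SymmetricField.algebraMap_injective k L
    exact (ρ.algebraMap_symAct 1 x).trans (by rw [map_one]; rfl)
  mul_smul g h x := by
    apply SymmetricField.algebraMap_injective k L
    change algebraMap _ _ (ρ.symAct (g * h) x) = algebraMap _ _ (ρ.symAct g (ρ.symAct h x))
    rw [ρ.algebraMap_symAct, ρ.algebraMap_symAct, ρ.algebraMap_symAct, map_mul]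
    rfl
  smul_zero g := map_zero (ρ.symAct g)
  smul_add g := map_add (ρ.symAct g)
  smul_one g := map_one (ρ.symAct g)
  smul_mul g := map_mul (ρ.symAct g)

/-- Noether's finiteness theorem: the symmetric algebra is integral, hence finite, over the
invariants, and the Artin–Tate lemma applies. -/
lemma Representation.finiteType_symInvariants [Finite G] [FiniteDimensional k L]
    (ρ : Representation k G L) : Algebra.FiniteType k ρ.symInvariants := by
  let _ := ρ.symMulSemiringAction
  have : Algebra.IsInvariant ρ.symInvariants (SymmetricAlgebra k L) G :=
    ⟨fun b hb ↦ ⟨⟨b, hb⟩, rfl⟩⟩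
  have : Algebra.IsIntegral ρ.symInvariants (SymmetricAlgebra k L) :=
    Algebra.IsInvariant.isIntegral _ _ G
  have hk : Algebra.FiniteType k (SymmetricAlgebra k L) :=
    .equiv inferInstance
      (SymmetricAlgebra.equivMvPolynomial (Module.finBasis k L)).symm
  have : Algebra.FiniteType ρ.symInvariants (SymmetricAlgebra k L) :=
    .of_restrictScalars_finiteType k _ _
  have hfin : Module.Finite ρ.symInvariants (SymmetricAlgebra k L) :=
    Algebra.IsIntegral.finite
  exact ⟨fg_of_fg_of_fg k ρ.symInvariants (SymmetricAlgebra k L) hk.1 hfin.1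
    Subtype.val_injective⟩

/-- The field of fractions of the ring of polynomial invariants is the field of invariants. -/
lemma Representation.adjoin_symInvariants [Finite G] (ρ : Representation k G L) :
    IntermediateField.adjoin k (algebraMap (SymmetricAlgebra k L)
      (SymmetricField k L) '' ρ.symInvariants) = ρ.fieldAct.fixedField := by
  have := Fintype.ofFinite G
  have hinj := SymmetricField.algebraMap_injective k L
  have hmem : ∀ x, x ∈ ρ.symInvariants ↔ algebraMap _ _ x ∈ ρ.fieldAct.fixedField := by
    intro x
    rw [MonoidHom.mem_fixedField]
    exact forall_congr' fun g ↦ by rw [← ρ.algebraMap_symAct, hinj.eq_iff]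
  refine le_antisymm ?_ fun y hy ↦ ?_
  · rw [IntermediateField.adjoin_le_iff]
    rintro _ ⟨x, hx, rfl⟩
    exact (hmem x).mp hx
  · obtain ⟨a, b, hb, rfl⟩ := IsFractionRing.div_surjective
      (A := SymmetricAlgebra k L) y
    classical
    set N := ∏ g, ρ.symAct g b
    have hN : N ∈ ρ.symInvariants := by
      rw [hmem, MonoidHom.mem_fixedField]
      intro h
      rw [map_prod, map_prod]
      simp only [ρ.algebraMap_symAct]
      exact Fintype.prod_equiv (Equiv.mulLeft h) _ _ fun g ↦ by
        rw [Equiv.coe_mulLeft, map_mul]; rfl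
    have hN0 : algebraMap _ (SymmetricField k L) N ≠ 0 := by
      rw [map_prod, Finset.prod_ne_zero_iff]
      intro g _
      rw [ρ.algebraMap_symAct]
      simpa using nonZeroDivisors.ne_zero hb
    have hbN : b ∣ N := by
      have h1 : ρ.symAct 1 b = b := hinj (by rw [ρ.algebraMap_symAct, map_one]; rfl)
      conv_lhs => rw [← h1]
      exact Finset.dvd_prod_of_mem _ (Finset.mem_univ 1)
    obtain ⟨c, hc⟩ := hbN
    have hb0 : algebraMap _ (SymmetricField k L) b ≠ 0 := by
      simpa using nonZeroDivisors.ne_zero hb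
    have hy' : algebraMap _ (SymmetricField k L) a / algebraMap _ _ b =
        algebraMap _ _ (a * c) / algebraMap _ _ N := by
      rw [div_eq_div_iff hb0 hN0, hc, map_mul, map_mul]
      ring
    rw [hy'] at hy ⊢
    refine div_mem (IntermediateField.subset_adjoin _ _ ⟨a * c, ?_, rfl⟩)
      (IntermediateField.subset_adjoin _ _ ⟨N, hN, rfl⟩)
    rw [SetLike.mem_coe, hmem]
    have := mul_mem hy ((hmem N).mp hN)
    rwa [div_mul_cancel₀ _ hN0] at this

end SymInvariants

section PolyInvariants

variable {k G V : Type*} [Field k] [Group G] [AddCommGroup V] [Module k V]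

lemma Representation.dual_injective {ρ : Representation k G V}
    (hρ : Function.Injective ρ) : Function.Injective ρ.dual := by
  rw [injective_iff_map_eq_one]
  intro g hg
  have : ρ g⁻¹ = 1 := by
    ext v
    rw [← sub_eq_zero, ← Module.forall_dual_apply_eq_zero_iff k]
    intro φ
    have h := congr($hg φ v)
    rw [Representation.dual_apply] at h
    rw [map_sub, sub_eq_zero]
    exact h
  exact inv_eq_one.mp (hρ (this.trans (map_one ρ).symm))

end PolyInvariants


/-! ### Birational equivalence of affine varieties with the same function field -/

section Subalgebra

variable {k Ω : Type*} [Field k] [Field Ω] [Algebra k Ω]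

/-- The subalgebra generated by a subalgebra and the inverse of an element. -/
def Subalgebra.adjoinInv (C : Subalgebra k Ω) (c : Ω) : Subalgebra k Ω :=
  Algebra.adjoin k (C ∪ {c⁻¹})

variable {B C : Subalgebra k Ω} {c d : Ω}

lemma Subalgebra.le_adjoinInv (C : Subalgebra k Ω) (c : Ω) : C ≤ C.adjoinInv c :=
  fun _ hx ↦ Algebra.subset_adjoin (.inl hx)

lemma Subalgebra.inv_mem_adjoinInv (C : Subalgebra k Ω) (c : Ω) : c⁻¹ ∈ C.adjoinInv c :=
  Algebra.subset_adjoin (.inr rfl)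

lemma Subalgebra.adjoinInv_le (h : B ≤ C) (hc : c⁻¹ ∈ C) : B.adjoinInv c ≤ C :=
  Algebra.adjoin_le (Set.union_subset h (Set.singleton_subset_iff.mpr hc))

lemma Subalgebra.exists_mul_pow_mem {x : Ω} (hc : c ∈ C) (hc0 : c ≠ 0)
    (hx : x ∈ C.adjoinInv c) : ∃ n : ℕ, x * c ^ n ∈ C := by
  induction hx using Algebra.adjoin_induction with
  | mem x hx =>
    rcases hx with hx | rfl
    · exact ⟨0, by simpa using hx⟩
    · exact ⟨1, by rw [pow_one, inv_mul_cancel₀ hc0]; exact one_mem C⟩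
  | algebraMap r => exact ⟨0, by simp⟩
  | add x y _ _ hx hy =>
    obtain ⟨n, hn⟩ := hx
    obtain ⟨m, hm⟩ := hy
    refine ⟨n + m, ?_⟩
    rw [show (x + y) * c ^ (n + m) = x * c ^ n * c ^ m + y * c ^ m * c ^ n by ring]
    exact add_mem (mul_mem hn (pow_mem hc m)) (mul_mem hm (pow_mem hc n))
  | mul x y _ _ hx hy =>
    obtain ⟨n, hn⟩ := hx
    obtain ⟨m, hm⟩ := hy
    refine ⟨n + m, ?_⟩
    rw [show x * y * c ^ (n + m) = x * c ^ n * (y * c ^ m) by ring]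
    exact mul_mem hn hm

lemma Subalgebra.isLocalization_adjoinInv (hc : c ∈ C) (hc0 : c ≠ 0) :
    let _ := (Subalgebra.inclusion (C.le_adjoinInv c)).toAlgebra
    IsLocalization.Away (⟨c, hc⟩ : C) (C.adjoinInv c) := by
  intro _
  have hmap : ∀ x : C, (algebraMap C (C.adjoinInv c) x : Ω) = x := fun _ ↦ rfl
  refine ⟨?_, ?_, ?_⟩
  · rintro ⟨_, n, rfl⟩
    rw [map_pow]
    refine IsUnit.pow n (IsUnit.of_mul_eq_one ⟨c⁻¹, C.inv_mem_adjoinInv c⟩ (Subtype.ext ?_))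
    change c * c⁻¹ = 1
    exact mul_inv_cancel₀ hc0
  · rintro ⟨x, hx⟩
    obtain ⟨n, hn⟩ := C.exists_mul_pow_mem hc hc0 hx
    exact ⟨⟨⟨_, hn⟩, ⟨_, n, rfl⟩⟩, Subtype.ext rfl⟩
  · intro x y h
    exact ⟨1, by rw [Subalgebra.inclusion_injective (C.le_adjoinInv c) h]⟩

/-- A finitely generated subalgebra of the field generated by `C` is contained in a
localization of `C` at one element. -/
lemma Subalgebra.exists_le_adjoinInv (hB : B.FG)
    (h : (B : Set Ω) ⊆ IntermediateField.adjoin k (C : Set Ω)) :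
    ∃ c ∈ C, c ≠ 0 ∧ B ≤ C.adjoinInv c := by
  classical
  obtain ⟨T, rfl⟩ := hB
  have key : ∀ S : Finset Ω, (S : Set Ω) ⊆ IntermediateField.adjoin k (C : Set Ω) →
      ∃ c ∈ C, c ≠ 0 ∧ (S : Set Ω) ⊆ C.adjoinInv c := by
    intro S
    induction S using Finset.induction_on with
    | empty => exact fun _ ↦ ⟨1, one_mem C, one_ne_zero, by simp⟩
    | insert x S _ ih =>
      rw [Finset.coe_insert, Set.insert_subset_iff]
      rintro ⟨hx, hS⟩
      obtain ⟨c, hc, hc0, hcS⟩ := ih hS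
      obtain ⟨r, hr, s, hs, rfl⟩ := IntermediateField.mem_adjoin_iff_div.mp hx
      rw [Algebra.adjoin_eq] at hr hs
      obtain rfl | hs0 := eq_or_ne s 0
      · exact ⟨c, hc, hc0, Set.insert_subset (by simp) hcS⟩
      · have hle := C.le_adjoinInv (c * s)
        have hinv := C.inv_mem_adjoinInv (c * s)
        refine ⟨c * s, mul_mem hc hs, mul_ne_zero hc0 hs0, Set.insert_subset ?_
          (hcS.trans (Subalgebra.adjoinInv_le hle ?_))⟩
        · rw [show r / s = r * c * (c * s)⁻¹ by field_simp]
          exact mul_mem (mul_mem (hle hr) (hle hc)) hinv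
        · rw [show c⁻¹ = s * (c * s)⁻¹ by field_simp]
          exact mul_mem (hle hs) hinv
  obtain ⟨c, hc, hc0, hT⟩ := key T (Algebra.subset_adjoin.trans h)
  exact ⟨c, hc, hc0, Algebra.adjoin_le hT⟩

end Subalgebra

namespace AlgebraicGeometry.Scheme

variable {k Ω : Type u} [Field k] [Field Ω] [Algebra k Ω]

/-- The structure morphism of the spectrum of an algebra. -/
noncomputable abbrev specStr (k A : Type u) [CommRing k] [CommRing A] [Algebra k A] :
    Spec (CommRingCat.of A) ⟶ Spec (CommRingCat.of k) :=
  Spec.map (CommRingCat.ofHom (algebraMap k A))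

lemma birationalOver_of_iso {S X Y : Scheme.{u}} {sX : X ⟶ S} {sY : Y ⟶ S} (e : X ≅ Y)
    (h : e.hom ≫ sY = sX) : BirationalOver sX sY :=
  e.hom.birationalOver sY sX h

lemma birationalOver_specStr_of_algEquiv {A B : Type u} [CommRing A] [CommRing B] [Algebra k A]
    [Algebra k B] (e : A ≃ₐ[k] B) : BirationalOver (specStr k A) (specStr k B) := by
  refine birationalOver_of_iso (Scheme.Spec.mapIso e.symm.toRingEquiv.toCommRingCatIso.op) ?_
  change Spec.map _ ≫ Spec.map _ = _
  rw [← Spec.map_comp]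
  congr 1
  ext x
  exact e.symm.commutes x

/-- Inverting a nonzero element of a domain gives a dominant open immersion of spectra. -/
lemma birationalOver_adjoinInv {C : Subalgebra k Ω} {c : Ω} (hc : c ∈ C) (hc0 : c ≠ 0) :
    BirationalOver (specStr k (C.adjoinInv c)) (specStr k C) := by
  let _ := (Subalgebra.inclusion (C.le_adjoinInv c)).toAlgebra
  have : IsLocalization.Away (⟨c, hc⟩ : C) (C.adjoinInv c) := C.isLocalization_adjoinInv hc hc0
  let f := Spec.map (CommRingCat.ofHom (algebraMap C (C.adjoinInv c)))
  have : IsOpenImmersion f := IsOpenImmersion.of_isLocalization (⟨c, hc⟩ : C)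
  have : IsDominant f := ⟨by
    refine (PrimeSpectrum.denseRange_comap_iff_ker_le_nilRadical
      (algebraMap C (C.adjoinInv c))).mpr ?_
    rw [(RingHom.injective_iff_ker_eq_bot (algebraMap C (C.adjoinInv c))).mp
      (Subalgebra.inclusion_injective (C.le_adjoinInv c))]
    exact bot_le⟩
  refine f.birationalOver _ _ ?_
  rw [← Spec.map_comp]
  rfl

/-- Finite generation puts B in A[1/a] and A in B[1/b]; inverting both `a` and `b` gives the same
algebra from either side, a common open subvariety. -/
lemma birationalOver_subalgebra {A B : Subalgebra k Ω} (hA : A.FG) (hB : B.FG)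
    (h : IntermediateField.adjoin k (A : Set Ω) = IntermediateField.adjoin k (B : Set Ω)) :
    BirationalOver (specStr k A) (specStr k B) := by
  obtain ⟨a, ha, ha0, hBa⟩ := Subalgebra.exists_le_adjoinInv (C := A) hB
    ((IntermediateField.subset_adjoin k _).trans h.ge)
  obtain ⟨b, hb, hb0, hAb⟩ := Subalgebra.exists_le_adjoinInv (C := B) hA
    ((IntermediateField.subset_adjoin k _).trans h.le)
  have heq : (A.adjoinInv a).adjoinInv b = (B.adjoinInv b).adjoinInv a := by
    refine le_antisymm ?_ ?_
    · exact Subalgebra.adjoinInv_le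
        (Subalgebra.adjoinInv_le (hAb.trans (Subalgebra.le_adjoinInv _ _))
          (Subalgebra.inv_mem_adjoinInv _ _))
        (Subalgebra.le_adjoinInv _ _ (Subalgebra.inv_mem_adjoinInv _ _))
    · exact Subalgebra.adjoinInv_le
        (Subalgebra.adjoinInv_le (hBa.trans (Subalgebra.le_adjoinInv _ _))
          (Subalgebra.inv_mem_adjoinInv _ _))
        (Subalgebra.le_adjoinInv _ _ (Subalgebra.inv_mem_adjoinInv _ _))
  have h1 := (birationalOver_adjoinInv (hBa hb) hb0).trans (birationalOver_adjoinInv ha ha0)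
  have h2 := (birationalOver_adjoinInv (hAb ha) ha0).trans (birationalOver_adjoinInv hb hb0)
  rw [heq] at h1
  exact h1.symm.trans h2

/-- Integral affine varieties with the same function field are birational. -/
theorem birationalOver_of_adjoin_range_eq {A B : Type u} [CommRing A] [CommRing B] [Algebra k A]
    [Algebra k B] [Algebra.FiniteType k A] [Algebra.FiniteType k B] {φ : A →ₐ[k] Ω}
    {ψ : B →ₐ[k] Ω} (hφ : Function.Injective φ) (hψ : Function.Injective ψ)
    (h : IntermediateField.adjoin k (Set.range φ) = IntermediateField.adjoin k (Set.range ψ)) :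
    BirationalOver (specStr k A) (specStr k B) := by
  have hfg : ∀ {C : Type u} [CommRing C] [Algebra k C] [Algebra.FiniteType k C] (χ : C →ₐ[k] Ω),
      χ.range.FG := fun χ ↦ by
    rw [← Algebra.map_top]
    exact Algebra.FiniteType.out.map χ
  exact ((birationalOver_specStr_of_algEquiv (AlgEquiv.ofInjective φ hφ)).trans
    (birationalOver_subalgebra (hfg φ) (hfg ψ) (by simpa using h))).trans
    (birationalOver_specStr_of_algEquiv (AlgEquiv.ofInjective ψ hψ)).symm

lemma birationalOver_affineSpace (k A n : Type u) [CommRing k] [CommRing A] [Algebra k A] :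
    BirationalOver ((𝔸(n; Spec (CommRingCat.of A)) ↘ Spec (CommRingCat.of A)) ≫ specStr k A)
      (specStr k (MvPolynomial n A)) := by
  refine (birationalOver_of_iso (AffineSpace.SpecIso n (CommRingCat.of A)).symm ?_).symm
  rw [Iso.symm_hom, AffineSpace.SpecIso_inv_over_assoc, ← Spec.map_comp]
  rfl

end AlgebraicGeometry.Scheme


/-! ### From function fields to stable rationality of the quotient -/

section StablyRational

lemma IntermediateField.aeval_mem_adjoin {k Ω ι : Type*} [Field k] [Field Ω] [Algebra k Ω]
    (y : ι → Ω) (p : MvPolynomial ι k) :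
    MvPolynomial.aeval y p ∈ IntermediateField.adjoin k (Set.range y) := by
  apply IntermediateField.algebra_adjoin_le_adjoin
  rw [Algebra.adjoin_range_eq_range_aeval]
  exact ⟨p, rfl⟩

lemma IntermediateField.adjoin_range_aeval {k Ω ι : Type*} [Field k] [Field Ω] [Algebra k Ω]
    (y : ι → Ω) : IntermediateField.adjoin k (Set.range (MvPolynomial.aeval (R := k) y)) =
      IntermediateField.adjoin k (Set.range y) := by
  refine le_antisymm (IntermediateField.adjoin_le_iff.mpr ?_)
    (IntermediateField.adjoin.mono _ _ _ ?_)
  · rintro _ ⟨p, rfl⟩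
    exact IntermediateField.aeval_mem_adjoin y p
  · rintro _ ⟨i, rfl⟩
    exact ⟨MvPolynomial.X i, MvPolynomial.aeval_X y i⟩

variable {k Ω : Type u} [Field k] [Field Ω] [Algebra k Ω]

/-- An integral affine variety is stably rational if its function field becomes rational after
a purely transcendental extension. -/
lemma isStablyRationalOver_specStr {A : Type u} [CommRing A] [Algebra k A]
    [Algebra.FiniteType k A] {θ : A →ₐ[k] Ω} (hθ : Function.Injective θ)
    {E E' : IntermediateField k Ω} (hE : IntermediateField.adjoin k (Set.range θ) = E)
    (hE' : E.IsPurelyTranscendental E') (hr : E'.IsRational) :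
    IsStablyRationalOver (Scheme.specStr k A) := by
  obtain ⟨m, t, ht, htE⟩ := hE'
  obtain ⟨n, s, hs, hsE⟩ := hr
  have hn := Scheme.birationalOver_affineSpace k k (ULift.{u} (Fin n))
  rw [show Scheme.specStr k k = 𝟙 _ from Spec.map_id _] at hn
  refine ⟨m, n, (Scheme.birationalOver_affineSpace k A _).trans (.trans ?_ hn.symm)⟩
  have hθE : ∀ a, θ a ∈ E := fun a ↦ hE ▸ IntermediateField.subset_adjoin _ _ ⟨a, rfl⟩
  let θ' : A →ₐ[k] E := θ.codRestrict E.toSubalgebra hθE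
  have hθ' : Function.Injective θ' := fun a b h ↦ hθ congr($h.1)
  -- Sending the variables to `t` embeds the coordinate ring of Spec A × 𝔸^m in `Ω`, with function
  -- field E(t) = E'. The map `ψ` does the same for 𝔸^n and k(s), the same field.
  let φ : MvPolynomial (ULift.{u} (Fin m)) A →ₐ[k] Ω :=
    ((MvPolynomial.aeval (R := E) (t ∘ ULift.down)).restrictScalars k).comp
      (MvPolynomial.mapAlgHom θ')
  let ψ : MvPolynomial (ULift.{u} (Fin n)) k →ₐ[k] Ω := MvPolynomial.aeval (s ∘ ULift.down)
  have ht' : Function.Injective (MvPolynomial.aeval (R := E) (t ∘ ULift.down.{u})) :=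
    ht.comp ULift.down ULift.down_injective
  have hφ : Function.Injective φ := fun p q h ↦
    MvPolynomial.map_injective θ'.toRingHom hθ' (ht' h)
  have hψ : Function.Injective ψ := hs.comp ULift.down ULift.down_injective
  have : Algebra.FiniteType k (MvPolynomial (ULift.{u} (Fin m)) A) :=
    .trans (S := A) inferInstance inferInstance
  refine Scheme.birationalOver_of_adjoin_range_eq hφ hψ (.trans (b := E') ?_ ?_)
  · refine le_antisymm ?_ ?_
    · rw [IntermediateField.adjoin_le_iff, htE]
      rintro _ ⟨p, rfl⟩
      have h := IntermediateField.aeval_mem_adjoin (k := E) (t ∘ ULift.down.{u})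
        (MvPolynomial.map θ'.toRingHom p)
      rw [ULift.down_surjective.range_comp] at h
      exact h
    · have hEφ : E ≤ IntermediateField.adjoin k (Set.range φ) := by
        rw [← hE, IntermediateField.adjoin_le_iff]
        rintro _ ⟨a, rfl⟩
        refine IntermediateField.subset_adjoin _ _ ⟨MvPolynomial.C a, ?_⟩
        simp [φ, θ']
        rfl
      rw [htE]
      refine (IntermediateField.adjoin_le_iff (F := E)
        (T := IntermediateField.extendScalars hEφ)).mpr ?_
      rintro _ ⟨i, rfl⟩
      rw [SetLike.mem_coe, IntermediateField.mem_extendScalars]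
      refine IntermediateField.subset_adjoin _ _ ⟨MvPolynomial.X ⟨i⟩, ?_⟩
      simp [φ]
  · exact hsE.trans ((congrArg (IntermediateField.adjoin k)
      (ULift.down_surjective.range_comp s)).symm.trans
      (IntermediateField.adjoin_range_aeval (s ∘ ULift.down.{u})).symm)

end StablyRational

/-- The no-name lemma is used twice on L ⊕ U: over k(U)^G it shows that k(L ⊕ U)^G is rational, and
over k(L)^G that this field is a purely transcendental extension of the function field in question.
-/
theorem HasRationalInvariants.isStablyRationalOver_symInvariants {k L : Type u} {G : Type*} [Field k] [Group G]
    [Finite G] [AddCommGroup L] [Module k L] [FiniteDimensional k L]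
    (hG : HasRationalInvariants k G) {δ : Representation k G L} (hδ : Function.Injective δ) :
    IsStablyRationalOver (Scheme.specStr k δ.symInvariants) := by
  obtain ⟨U, _, _, τ, hfd, hτ, hr⟩ := hG
  have := δ.finiteType_symInvariants
  let σ := δ.prod τ
  have hinl : Function.Injective (LinearMap.inl k L U) := LinearMap.inl_injective
  have hinr : Function.Injective (LinearMap.inr k L U) := LinearMap.inr_injective
  have hl : ∀ g v, LinearMap.inl k L U (δ g v) = σ g (LinearMap.inl k L U v) := fun g v ↦ by
    simp [σ]
  have hr' : ∀ g v, LinearMap.inr k L U (τ g v) = σ g (LinearMap.inr k L U v) := fun g v ↦ by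
    simp [σ]
  have hsup : (LinearMap.inl k L U).range ⊔ (LinearMap.inr k L U).range = ⊤ :=
    LinearMap.sup_range_inl_inr
  have h1 := Representation.isPurelyTranscendental_fixedField hδ hinl hl hr' hsup
    (Module.finrank_prod ..).symm
  have h2 := Representation.isPurelyTranscendental_fixedField hτ hinr hr' hl
    (sup_comm _ _ |>.trans hsup) ((add_comm _ _).trans (Module.finrank_prod ..).symm)
  let f := SymmetricField.map (LinearMap.inl k L U) hinl
  let θ : δ.symInvariants →ₐ[k] SymmetricField k (L × U) :=
    (f.comp (IsScalarTower.toAlgHom k (SymmetricAlgebra k L) _)).comp δ.symInvariants.val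
  have hθ : Function.Injective θ :=
    (f.injective.comp (SymmetricField.algebraMap_injective k L)).comp Subtype.val_injective
  refine isStablyRationalOver_specStr hθ ?_ h1 ((hr.map _).trans h2)
  rw [← δ.adjoin_symInvariants, IntermediateField.adjoin_map, ← Set.image_comp]
  congr 1
  exact (Set.range_comp (f ∘ algebraMap (SymmetricAlgebra k L) _)
    δ.symInvariants.val).trans (by rw [Subalgebra.coe_val, Subtype.range_coe])

/-- The polynomial invariants of `ρ` are by definition those of the symmetric algebra for the dual
representation, which is again faithful. -/
theorem HasRationalInvariants.isStablyRationalOver {k V : Type u} {G : Type*} [Field k] [Group G]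
    [Finite G] [AddCommGroup V] [Module k V] [FiniteDimensional k V]
    (hG : HasRationalInvariants k G) {ρ : Representation k G V} (hρ : Function.Injective ρ) :
    IsStablyRationalOver ρ.quotientVarietyStr :=
  hG.isStablyRationalOver_symInvariants (Representation.dual_injective hρ)

theorem mainTheorem8
    {k : Type u} [Field k] [IsAlgClosed k]
    {F : Type*} [Field F] [Finite F] (n : ℕ)
    (ℓ : ℕ) [Fact ℓ.Prime] (hℓ : ¬ ℓ ∣ Nat.card F)
    (G : Sylow ℓ (GL (Fin n) F))
    {V : Type u} [AddCommGroup V] [Module k V] [FiniteDimensional k V]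
    (ρ : Representation k G V) (hρ : Function.Injective ρ) :
    IsStablyRationalOver ρ.quotientVarietyStr := by
  have h : HasRationalInvariants k G := by
    -- If ℓ = char k there are no nontrivial ℓ-power roots of unity to build characters from; the
    -- given `ρ` then already has rational invariants on its own symmetric algebra.
    by_cases hk : (ℓ : k) = 0
    · exact G.isPGroup'.hasRationalInvariants hk hρ
    · exact G.hasRationalInvariants_GL k hk hℓ
  exact h.isStablyRationalOver hρ
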